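/- Let $\widetilde{SL}_2$ be the universal covering group of $SL(2,\mathbb R)\cong SU(1,1)$ with the left-invariant metric and the orientation for which $e_j=\tfrac12 f_j$, $j=1,2,3$, is a positive orthonormal basis of the Lie algebra, where $$f_1=\begin{pmatrix}0&1\\1&0\end{pmatrix},\quad f_2=\begin{pmatrix}0&i\\-i&0\end{pmatrix},\quad f_3=\begin{pmatrix}\frac i2&0\\0&-\frac i2\end{pmatrix},$$ so that $[f_1,f_2]=-4f_3$, $[f_1,f_3]=-f_2$, $[f_2,f_3]=f_1$. Let $f:M\to\widetilde{SL}_2$ be a smooth immersion of a closed oriented surface, and regard $M$ as a compact Riemann surface whose holomorphic charts $z=x+iy$ are the positively oriented conformal parameters of the induced metric $e^{2\alpha}dz\,d\bar z$. Put $\partial=\tfrac12(\partial_x-i\partial_y)$, $\bar\partial=\tfrac12(\partial_x+i\partial_y)$, and write $f^{-1}\partial f=Z_1e_1+Z_2e_2+Z_3e_3$. A generating spinor on an open part of a chart is a pair $(\psi_1,\psi_2)$ of $C^1$ complex functions with $$Z_1=\tfrac i2(\bar\psi_2^2+\psi_1^2),\qquad Z_2=\tfrac12(\bar\psi_2^2-\psi_1^2),\qquad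 Z_3=\psi_1\bar\psi_2 .$$ It exists locally and is unique up to a locally constant sign, so $|\psi_1|^2$ and $|\psi_2|^2$ are defined in each chart. Let $H$ be the mean curvature (half the trace of the second fundamental form) with respect to the unit normal $N$ for which $(f_x,f_y,N)$ is positively oriented. In each chart there are unique continuous complex-valued functions $U,V$ such that every generating spinor on an open part of the chart satisfies the Dirac equation $$\partial\psi_2+U\psi_1=0,\qquad -\bar\partial\psi_1+V\psi_2=0,$$ and the energy of the surface is $$E(M)=\int_M UV\,dx\wedge dy=\int_M UV\,\frac{i\,dz\wedge d\bar z}{2}.$$ Then $E(M)$ is real and $$E(M)=\int_M\left[\frac{H^2}{4}\left(|\psi_1|^2+|\psi_2|^2\right)^2-\left(\tfrac12|\psi_1|^2-\tfrac34|\psi_2|^2\right)\left(\tfrac34|\psi_1|^2-\tfrac12|\psi_2|^2\right)\right]\frac{i\,dz\wedge d\bar z}{2}.$$ -/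

import Mathlib

open scoped Manifold ContDiff Matrix

noncomputable section

/-! ### The group `SL̃₂`, the universal covering group of `SL(2, ℝ)`

An element of `SL(2, ℝ)` is an `ℝ`-linear map `w ↦ a * w + b * conj w` of `ℂ` with
`|a|² - |b|² = 1`, equivalently the matrix `(a, b; conj b, conj a)` of `SU(1, 1)`.  Since
`|a| = √(1 + |b|²)`, it is determined by `b` and by `a / |a|`.  Unwinding the
circle of values of `a / |a| = exp (i θ)` gives the universal covering, with global
coordinates `(θ, b) ∈ ℝ × ℂ`. -/

/-- The universal covering of `SL(2, ℝ)`: the pair `(θ, b)` lies above the linear map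
`w ↦ a * w + b * conj w`, where `a = √(1 + |b|²) * exp (i θ)`. -/
def SLTilde : Type := ℝ × ℂ

namespace SLTilde

instance : TopologicalSpace SLTilde := inferInstanceAs (TopologicalSpace (ℝ × ℂ))

instance : ChartedSpace (ℝ × ℂ) SLTilde := inferInstanceAs (ChartedSpace (ℝ × ℂ) (ℝ × ℂ))

instance : IsManifold 𝓘(ℝ, ℝ × ℂ) ω SLTilde :=
  inferInstanceAs (IsManifold 𝓘(ℝ, ℝ × ℂ) ω (ℝ × ℂ))

/-- The lifted angle of `a`. -/
def theta (g : SLTilde) : ℝ := g.1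

/-- The coefficient of `conj w`. -/
def b (g : SLTilde) : ℂ := g.2

/-- The coefficient of `w`. -/
def a (g : SLTilde) : ℂ := (√(1 + ‖g.b‖ ^ 2) : ℝ) * Complex.exp (g.theta * Complex.I)

lemma norm_a (g : SLTilde) : ‖g.a‖ = √(1 + ‖g.b‖ ^ 2) := by
  rw [a, norm_mul, Complex.norm_exp_ofReal_mul_I, mul_one, Complex.norm_real, Real.norm_eq_abs,
    abs_of_nonneg (Real.sqrt_nonneg _)]

lemma norm_a_sq (g : SLTilde) : ‖g.a‖ ^ 2 = 1 + ‖g.b‖ ^ 2 := by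
  rw [norm_a, Real.sq_sqrt (by positivity)]

lemma a_ne_zero (g : SLTilde) : g.a ≠ 0 := by
  intro h
  have := g.norm_a_sq
  rw [h, norm_zero] at this
  nlinarith [sq_nonneg ‖g.b‖]

/-- The quotient of the coefficient of `w` in a composition by the product of the coefficients
of `w` in the factors; it lies in the right half plane. -/
def cocycle (g h : SLTilde) : ℂ := 1 + g.b * (starRingEnd ℂ) h.b / (g.a * h.a)

lemma norm_b_lt (g : SLTilde) : ‖g.b‖ < ‖g.a‖ := by
  have := g.norm_a_sq
  exact lt_of_pow_lt_pow_left₀ 2 (norm_nonneg _) (by linarith)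

lemma cocycle_re_pos (g h : SLTilde) : 0 < (cocycle g h).re := by
  have hn : ‖g.b * (starRingEnd ℂ) h.b / (g.a * h.a)‖ < 1 := by
    rw [norm_div, norm_mul, norm_mul, RCLike.norm_conj, div_lt_one
      (mul_pos (norm_pos_iff.2 g.a_ne_zero) (norm_pos_iff.2 h.a_ne_zero))]
    exact mul_lt_mul'' g.norm_b_lt h.norm_b_lt (norm_nonneg _) (norm_nonneg _)
  have := (abs_le.1 (Complex.abs_re_le_norm (g.b * (starRingEnd ℂ) h.b / (g.a * h.a)))).1
  rw [cocycle, Complex.add_re, Complex.one_re]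
  linarith

/-- The lift of the composition of linear maps. -/
instance : Mul SLTilde :=
  ⟨fun g h => (g.theta + h.theta + (cocycle g h).arg, g.a * h.b + g.b * (starRingEnd ℂ) h.a)⟩

instance : One SLTilde := ⟨((0 : ℝ), (0 : ℂ))⟩

instance : Inv SLTilde := ⟨fun g => (-g.theta, -g.b)⟩

lemma theta_mul (g h : SLTilde) :
    (g * h).theta = g.theta + h.theta + (cocycle g h).arg := rfl

lemma b_mul (g h : SLTilde) : (g * h).b = g.a * h.b + g.b * (starRingEnd ℂ) h.a := rfl

lemma theta_one : (1 : SLTilde).theta = 0 := rfl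

lemma b_one : (1 : SLTilde).b = 0 := rfl

lemma a_one : (1 : SLTilde).a = 1 := by simp [a, b_one, theta_one]

lemma b_inv (g : SLTilde) : (g⁻¹).b = -g.b := rfl

lemma theta_inv (g : SLTilde) : (g⁻¹).theta = -g.theta := rfl

lemma a_eq_norm_mul (g : SLTilde) : g.a = ‖g.a‖ * Complex.exp (g.theta * Complex.I) := by
  rw [norm_a, a]

lemma a_inv (g : SLTilde) : (g⁻¹).a = (starRingEnd ℂ) g.a := by
  simp [a, b_inv, theta_inv, ← Complex.exp_conj]

lemma a_mul_eq (g h : SLTilde) :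
    g.a * h.a * cocycle g h = g.a * h.a + g.b * (starRingEnd ℂ) h.b := by
  have h1 := g.a_ne_zero
  have h2 := h.a_ne_zero
  rw [cocycle]
  field_simp

lemma normSq_identity (x y u v : ℂ) :
    ‖x * v + y * (starRingEnd ℂ) u‖ ^ 2 + (‖x‖ ^ 2 - ‖y‖ ^ 2) * (‖u‖ ^ 2 - ‖v‖ ^ 2) =
      ‖x * u + y * (starRingEnd ℂ) v‖ ^ 2 := by
  simp only [Complex.sq_norm, Complex.normSq_apply, Complex.add_re, Complex.add_im,
    Complex.mul_re, Complex.mul_im, Complex.conj_re, Complex.conj_im]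
  ring

lemma a_mul (g h : SLTilde) : (g * h).a = g.a * h.a + g.b * (starRingEnd ℂ) h.b := by
  have hn : ‖(g * h).a‖ = ‖g.a‖ * ‖h.a‖ * ‖cocycle g h‖ := by
    rw [← norm_mul, ← norm_mul, a_mul_eq]
    refine (pow_left_inj₀ (norm_nonneg _) (norm_nonneg _) two_ne_zero).1 ?_
    rw [← normSq_identity, norm_a_sq, b_mul, g.norm_a_sq, h.norm_a_sq]
    ring
  rw [← a_mul_eq, a_eq_norm_mul (g * h), hn, theta_mul]
  conv_rhs => rw [a_eq_norm_mul g, a_eq_norm_mul h, ← Complex.norm_mul_exp_arg_mul_I (cocycle g h)]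
  push_cast
  rw [add_mul, add_mul, Complex.exp_add, Complex.exp_add]
  ring

lemma ext_of_abs_lt {g h : SLTilde} (hb : g.b = h.b) (ha : g.a = h.a)
    (ht : |g.theta - h.theta| < 2 * Real.pi) : g = h := by
  refine Prod.ext ?_ hb
  have hne : (‖g.a‖ : ℂ) ≠ 0 := by exact_mod_cast norm_ne_zero_iff.2 g.a_ne_zero
  have he : Complex.exp (g.theta * Complex.I) = Complex.exp (h.theta * Complex.I) := by
    have h1 := a_eq_norm_mul g
    have h2 := a_eq_norm_mul h
    rw [← ha] at h2
    exact mul_left_cancel₀ hne (h1.symm.trans h2)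
  obtain ⟨n, hn⟩ := Complex.exp_eq_exp_iff_exists_int.1 he
  have hn' : g.theta = h.theta + n * (2 * Real.pi) := by
    have := congrArg Complex.im hn
    simpa using this
  have hpi := Real.pi_pos
  have hn0 : n = 0 := by
    rw [hn', add_sub_cancel_left, abs_mul, abs_of_pos (by positivity : 0 < 2 * Real.pi)] at ht
    have : |(n : ℝ)| < 1 := by
      by_contra hcon
      nlinarith
    have h3 : |n| < 1 := by exact_mod_cast this
    exact Int.abs_lt_one_iff.1 h3
  rw [hn0] at hn'
  simpa [theta] using hn'

lemma abs_arg_cocycle_lt (g h : SLTilde) : |(cocycle g h).arg| < Real.pi / 2 :=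
  Complex.abs_arg_lt_pi_div_two_iff.2 (Or.inl (cocycle_re_pos g h))

instance : Group SLTilde where
  mul_assoc g h k := by
    refine ext_of_abs_lt ?_ ?_ ?_
    · simp only [b_mul, a_mul, map_add, map_mul, Complex.conj_conj]
      ring
    · simp only [b_mul, a_mul, map_add, map_mul, Complex.conj_conj]
      ring
    · have h1 := abs_lt.1 (abs_arg_cocycle_lt (g * h) k)
      have h2 := abs_lt.1 (abs_arg_cocycle_lt g h)
      have h3 := abs_lt.1 (abs_arg_cocycle_lt g (h * k))
      have h4 := abs_lt.1 (abs_arg_cocycle_lt h k)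
      simp only [theta_mul]
      rw [abs_lt]
      constructor <;> linarith [h1.1, h1.2, h2.1, h2.2, h3.1, h3.2, h4.1, h4.2]
  one_mul g := by
    refine ext_of_abs_lt ?_ ?_ ?_
    · simp [b_mul, a_one, b_one]
    · simp [a_mul, a_one, b_one]
    · simp [theta_mul, theta_one, cocycle, b_one, Real.pi_pos]
  mul_one g := by
    refine ext_of_abs_lt ?_ ?_ ?_
    · simp [b_mul, a_one, b_one]
    · simp [a_mul, a_one, b_one]
    · simp [theta_mul, theta_one, cocycle, b_one, Real.pi_pos]
  inv_mul_cancel g := by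
    have hpi := Real.pi_pos
    refine ext_of_abs_lt ?_ ?_ ?_
    · simp only [b_mul, a_inv, b_inv, b_one]
      ring
    · rw [a_mul, a_inv, b_inv, a_one, neg_mul, Complex.mul_conj, mul_comm, Complex.mul_conj,
        Complex.normSq_eq_norm_sq, Complex.normSq_eq_norm_sq, norm_a_sq]
      push_cast
      ring
    · have h1 := abs_lt.1 (abs_arg_cocycle_lt g⁻¹ g)
      rw [theta_mul, theta_inv, theta_one, abs_lt]
      constructor <;> linarith [h1.1, h1.2]

/-- The covering homomorphism `SL̃₂ → SL(2, ℝ)`: the matrix of `w ↦ a * w + b * conj w` in the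
basis `1, i` of `ℂ`. -/
def proj : SLTilde →* Matrix.SpecialLinearGroup (Fin 2) ℝ where
  toFun g := ⟨!![g.a.re + g.b.re, g.b.im - g.a.im; g.a.im + g.b.im, g.a.re - g.b.re], by
    have h := g.norm_a_sq
    rw [Complex.sq_norm, Complex.sq_norm, Complex.normSq_apply, Complex.normSq_apply] at h
    rw [Matrix.det_fin_two_of]
    linarith⟩
  map_one' := by
    ext i j
    fin_cases i <;> fin_cases j <;> simp [a_one, b_one]
  map_mul' g h := by
    refine Subtype.ext ?_
    change (_ : Matrix (Fin 2) (Fin 2) ℝ) = _ * _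
    ext i j
    fin_cases i <;> fin_cases j <;>
      simp [a_mul, b_mul, Matrix.mul_apply, Fin.sum_univ_two] <;> ring

lemma contDiff_a : ContDiff ℝ ω (fun g : ℝ × ℂ => a g) := by
  have h : (fun g : ℝ × ℂ => a g) = fun g : ℝ × ℂ =>
      ((√(1 + ‖g.2‖ ^ 2) : ℝ) : ℂ) * Complex.exp (g.1 * Complex.I) := rfl
  rw [h]
  have h1 : ContDiff ℝ ω (fun g : ℝ × ℂ => √(1 + ‖g.2‖ ^ 2)) := by
    refine ContDiff.sqrt (contDiff_const.add (contDiff_snd.norm_sq ℝ)) fun x => by positivity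
  have h2 : ContDiff ℝ ω (fun g : ℝ × ℂ => (g.1 : ℂ)) :=
    Complex.ofRealCLM.contDiff.comp contDiff_fst
  exact (Complex.ofRealCLM.contDiff.comp h1).mul (h2.mul contDiff_const).cexp

lemma contDiff_b : ContDiff ℝ ω (fun g : ℝ × ℂ => b g) := contDiff_snd

lemma contDiff_mul : ContDiff ℝ ω (fun p : (ℝ × ℂ) × (ℝ × ℂ) =>
    ((p.1.1 + p.2.1 + (cocycle p.1 p.2).arg, a p.1 * b p.2 + b p.1 * (starRingEnd ℂ) (a p.2)) :
      ℝ × ℂ)) := by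
  have ha1 : ContDiff ℝ ω (fun p : (ℝ × ℂ) × (ℝ × ℂ) => a p.1) := contDiff_a.comp contDiff_fst
  have ha2 : ContDiff ℝ ω (fun p : (ℝ × ℂ) × (ℝ × ℂ) => a p.2) := contDiff_a.comp contDiff_snd
  have hb1 : ContDiff ℝ ω (fun p : (ℝ × ℂ) × (ℝ × ℂ) => b p.1) := contDiff_b.comp contDiff_fst
  have hb2 : ContDiff ℝ ω (fun p : (ℝ × ℂ) × (ℝ × ℂ) => b p.2) := contDiff_b.comp contDiff_snd
  have hc : ContDiff ℝ ω (fun w : ℂ => (starRingEnd ℂ) w) := Complex.conjCLE.contDiff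
  have hco : ContDiff ℝ ω (fun p : (ℝ × ℂ) × (ℝ × ℂ) => cocycle p.1 p.2) := by
    simp only [cocycle, div_eq_mul_inv]
    exact contDiff_const.add ((hb1.mul (hc.comp hb2)).mul ((ha1.mul ha2).inv
      fun p => mul_ne_zero (a_ne_zero _) (a_ne_zero _)))
  have harg : ContDiff ℝ ω (fun p : (ℝ × ℂ) × (ℝ × ℂ) => (cocycle p.1 p.2).arg) := by
    have : (fun p : (ℝ × ℂ) × (ℝ × ℂ) => (cocycle p.1 p.2).arg) =
        fun p => Complex.imCLM (Complex.log (cocycle p.1 p.2)) := by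
      ext p
      simp [Complex.log_im]
    rw [this]
    refine Complex.imCLM.contDiff.comp (contDiff_iff_contDiffAt.2 fun p => ?_)
    exact ((Complex.contDiffAt_log (Or.inl (cocycle_re_pos _ _))).restrict_scalars ℝ).comp p
      hco.contDiffAt
  exact (((contDiff_fst.comp contDiff_fst).add (contDiff_fst.comp contDiff_snd)).add harg).prodMk
    ((ha1.mul hb2).add (hb1.mul (hc.comp ha2)))

instance : LieGroup 𝓘(ℝ, ℝ × ℂ) ω SLTilde where
  contMDiff_mul := by
    have h := contDiff_mul.contMDiff
    rw [modelWithCornersSelf_prod, ← chartedSpaceSelf_prod] at h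
    exact h
  contMDiff_inv := by
    have h : ContDiff ℝ ω (fun g : ℝ × ℂ => (-g.1, -g.2)) := contDiff_fst.neg.prodMk contDiff_snd.neg
    exact h.contMDiff

instance : SimplyConnectedSpace SLTilde :=
  inferInstanceAs (SimplyConnectedSpace (ℝ × ℂ))


instance : IsTopologicalGroup SLTilde := topologicalGroup_of_lieGroup 𝓘(ℝ, ℝ × ℂ) ω

/-- The coefficient `a` of an element of `SL(2, ℝ)`. -/
def coeffA (A : Matrix.SpecialLinearGroup (Fin 2) ℝ) : ℂ :=
  ⟨(A.1 0 0 + A.1 1 1) / 2, (A.1 1 0 - A.1 0 1) / 2⟩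

/-- The coefficient `b` of an element of `SL(2, ℝ)`. -/
def coeffB (A : Matrix.SpecialLinearGroup (Fin 2) ℝ) : ℂ :=
  ⟨(A.1 0 0 - A.1 1 1) / 2, (A.1 1 0 + A.1 0 1) / 2⟩

lemma norm_coeffA (A : Matrix.SpecialLinearGroup (Fin 2) ℝ) :
    ‖coeffA A‖ = √(1 + ‖coeffB A‖ ^ 2) := by
  have h := A.2
  rw [Matrix.det_fin_two] at h
  rw [eq_comm, Real.sqrt_eq_iff_mul_self_eq (by positivity) (norm_nonneg _), ← sq,
    Complex.sq_norm, Complex.sq_norm, Complex.normSq_apply, Complex.normSq_apply]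
  simp only [coeffA, coeffB]
  linear_combination -h

lemma norm_coeffA_ne_zero (A : Matrix.SpecialLinearGroup (Fin 2) ℝ) : ‖coeffA A‖ ≠ 0 := by
  rw [norm_coeffA]
  positivity

lemma continuous_coeffA : Continuous coeffA := by
  have h : coeffA = fun A => (((A.1 0 0 + A.1 1 1) / 2 : ℝ) : ℂ) +
      (((A.1 1 0 - A.1 0 1) / 2 : ℝ) : ℂ) * Complex.I := by
    ext A
    exact (Complex.mk_eq_add_mul_I _ _)
  rw [h]
  fun_prop

lemma continuous_coeffB : Continuous coeffB := by
  have h : coeffB = fun A => (((A.1 0 0 - A.1 1 1) / 2 : ℝ) : ℂ) +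
      (((A.1 1 0 + A.1 0 1) / 2 : ℝ) : ℂ) * Complex.I := by
    ext A
    exact (Complex.mk_eq_add_mul_I _ _)
  rw [h]
  fun_prop

lemma coeffA_proj (g : SLTilde) : coeffA (proj g) = g.a := by
  apply Complex.ext
  · change (g.a.re + g.b.re + (g.a.re - g.b.re)) / 2 = g.a.re
    ring
  · change (g.a.im + g.b.im - (g.b.im - g.a.im)) / 2 = g.a.im
    ring

lemma coeffB_proj (g : SLTilde) : coeffB (proj g) = g.b := by
  apply Complex.ext
  · change (g.a.re + g.b.re - (g.a.re - g.b.re)) / 2 = g.b.re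
    ring
  · change (g.a.im + g.b.im + (g.b.im - g.a.im)) / 2 = g.b.im
    ring

/-- The element of `SL(2, ℝ)` with given `a / |a|` and `b`. -/
def polarFun (u : Circle) (b : ℂ) : Matrix.SpecialLinearGroup (Fin 2) ℝ :=
  ⟨!![√(1 + ‖b‖ ^ 2) * (u : ℂ).re + b.re, b.im - √(1 + ‖b‖ ^ 2) * (u : ℂ).im;
      √(1 + ‖b‖ ^ 2) * (u : ℂ).im + b.im, √(1 + ‖b‖ ^ 2) * (u : ℂ).re - b.re], by
    have h1 : (u : ℂ).re * (u : ℂ).re + (u : ℂ).im * (u : ℂ).im = 1 := by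
      rw [← Complex.normSq_apply, Circle.normSq_coe]
    have h2 : √(1 + ‖b‖ ^ 2) ^ 2 = 1 + (b.re * b.re + b.im * b.im) := by
      rw [Real.sq_sqrt (by positivity), Complex.sq_norm, Complex.normSq_apply]
    rw [Matrix.det_fin_two_of]
    linear_combination √(1 + ‖b‖ ^ 2) ^ 2 * h1 + h2⟩

lemma coeffA_polarFun (u : Circle) (b : ℂ) :
    coeffA (polarFun u b) = (√(1 + ‖b‖ ^ 2) : ℝ) * (u : ℂ) := by
  apply Complex.ext
  · rw [Complex.re_ofReal_mul]; simp [coeffA, polarFun]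
  · rw [Complex.im_ofReal_mul]; simp [coeffA, polarFun]; ring

lemma coeffB_polarFun (u : Circle) (b : ℂ) : coeffB (polarFun u b) = b := by
  apply Complex.ext
  · simp [coeffB, polarFun]
  · simp [coeffB, polarFun]; ring

/-- The coordinates `(a / |a|, b)` on `SL(2, ℝ)`. -/
def polar : Circle × ℂ ≃ₜ Matrix.SpecialLinearGroup (Fin 2) ℝ where
  toFun p := polarFun p.1 p.2
  invFun A := (⟨coeffA A / ‖coeffA A‖, by
    rw [Submonoid.unitSphere, Submonoid.mem_mk, Subsemigroup.mem_mk, mem_sphere_zero_iff_norm,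
      norm_div, Complex.norm_real, norm_norm, div_self (norm_coeffA_ne_zero A)]⟩, coeffB A)
  left_inv p := by
    refine Prod.ext (Circle.ext ?_) (coeffB_polarFun _ _)
    have hpos : (√(1 + ‖p.2‖ ^ 2) : ℝ) ≠ 0 := by positivity
    have hpos' : ((√(1 + ‖p.2‖ ^ 2) : ℝ) : ℂ) ≠ 0 := by exact_mod_cast hpos
    change coeffA (polarFun p.1 p.2) / (‖coeffA (polarFun p.1 p.2)‖ : ℂ) = p.1
    rw [norm_coeffA, coeffA_polarFun, coeffB_polarFun, mul_div_cancel_left₀ _ hpos']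
  right_inv A := by
    have hn := norm_coeffA_ne_zero A
    have h1 : ‖coeffA A‖ * (coeffA A / (‖coeffA A‖ : ℂ)).re = (coeffA A).re := by
      rw [Complex.div_ofReal_re]; field_simp
    have h2 : ‖coeffA A‖ * (coeffA A / (‖coeffA A‖ : ℂ)).im = (coeffA A).im := by
      rw [Complex.div_ofReal_im]; field_simp
    refine Subtype.ext ?_
    change !![_, _; _, _] = A.1
    simp only [← norm_coeffA]
    rw [h1, h2]
    ext i j
    fin_cases i <;> fin_cases j <;> simp [coeffA, coeffB] <;> ring
  continuous_toFun := by
    refine Continuous.subtype_mk (continuous_matrix fun i j => ?_) _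
    fin_cases i <;> fin_cases j <;> simp <;> fun_prop
  continuous_invFun := by
    refine Continuous.prodMk (Continuous.subtype_mk ?_ _) continuous_coeffB
    exact continuous_coeffA.div (Complex.continuous_ofReal.comp continuous_coeffA.norm)
      fun A => by exact_mod_cast norm_coeffA_ne_zero A

lemma proj_eq_polar (g : SLTilde) : proj g = polar (Circle.exp g.theta, g.b) := by
  have ha : g.a.re = √(1 + ‖g.b‖ ^ 2) * ((Circle.exp g.theta : Circle) : ℂ).re ∧
      g.a.im = √(1 + ‖g.b‖ ^ 2) * ((Circle.exp g.theta : Circle) : ℂ).im := by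
    rw [Circle.coe_exp, a, Complex.re_ofReal_mul, Complex.im_ofReal_mul]
    exact ⟨rfl, rfl⟩
  refine Subtype.ext ?_
  change !![g.a.re + g.b.re, g.b.im - g.a.im; g.a.im + g.b.im, g.a.re - g.b.re] = !![_, _; _, _]
  rw [ha.1, ha.2]

/-- `SL̃₂` is a covering of `SL(2, ℝ)`, the universal one since `SL̃₂` is simply connected. -/
theorem isCoveringMap_proj : IsCoveringMap proj := by
  have hq : Topology.IsQuotientMap proj := by
    have h1 : IsOpenQuotientMap (Prod.map Circle.exp (id : ℂ → ℂ)) :=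
      Circle.isAddQuotientCoveringMap_exp.isOpenQuotientMap.prodMap IsOpenQuotientMap.id
    have h2 := polar.isQuotientMap.comp h1.isQuotientMap
    have h3 : (proj : SLTilde → _) = fun g => polar (Prod.map Circle.exp (id : ℂ → ℂ) g) := by
      ext1 g
      exact proj_eq_polar g
    rw [h3]
    exact h2
  refine (hq.isQuotientCoveringMap_of_isDiscrete_ker_monoidHom ?_).isCoveringMap
  refine isDiscrete_iff_forall_mem_exists_isOpen.2 fun g hg =>
    ⟨{h | |theta h - theta g| < 2 * Real.pi}, ?_, ?_⟩
  · have hc : Continuous theta := continuous_fst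
    exact isOpen_lt (hc.sub continuous_const).abs continuous_const
  · refine Set.Subset.antisymm (fun h hh => ?_) (fun h hh => ?_)
    · have he : proj h = proj g := (MonoidHom.mem_ker.1 hh.2).trans (MonoidHom.mem_ker.1 hg).symm
      refine ext_of_abs_lt ?_ ?_ hh.1
      · rw [← coeffB_proj, he, coeffB_proj]
      · rw [← coeffA_proj, he, coeffA_proj]
    · rw [Set.mem_singleton_iff.1 hh]
      exact ⟨by simp [Real.pi_pos], hg⟩

/-! ### The Lie algebra, the left-invariant metric and its Levi-Civita connection -/

/-- The basis `e₁, e₂, e₃` (numbered from `0`) of the Lie algebra `sl(2, ℝ)`.  The elements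
`f_j = 2 e_j` are the linear maps `w ↦ conj w`, `w ↦ i * conj w`, `w ↦ (i / 2) * w`, and satisfy
`[f₁, f₂] = -4 f₃`, `[f₁, f₃] = -f₂`, `[f₂, f₃] = f₁`. -/
def basis : Fin 3 → Matrix (Fin 2) (Fin 2) ℝ :=
  ![!![1 / 2, 0; 0, -(1 / 2)], !![0, 1 / 2; 1 / 2, 0], !![0, -(1 / 4); 1 / 4, 0]]

/-- The coordinates of a traceless matrix in the basis `e₁, e₂, e₃`. -/
def coord (X : Matrix (Fin 2) (Fin 2) ℝ) : Fin 3 → ℝ :=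
  ![X 0 0 - X 1 1, X 0 1 + X 1 0, 2 * (X 1 0 - X 0 1)]

lemma sum_coord_smul_basis (X : Matrix (Fin 2) (Fin 2) ℝ) (hX : X.trace = 0) :
    ∑ k, coord X k • basis k = X := by
  have h : X 0 0 + X 1 1 = 0 := by simpa [Matrix.trace_fin_two] using hX
  ext i j
  fin_cases i <;> fin_cases j <;>
    simp [Fin.sum_univ_three, coord, basis] <;> linarith

lemma coord_basis (j : Fin 3) : coord (basis j) = Pi.single j 1 := by
  ext k
  fin_cases j <;> fin_cases k <;> simp [coord, basis] <;> norm_num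

/-- `α_{ijk} = ⟨[e_i, e_j], e_k⟩` for the inner product in which `e₁, e₂, e₃` is orthonormal. -/
def structureConst (i j k : Fin 3) : ℝ :=
  coord (basis i * basis j - basis j * basis i) k

/-- `⟨∇_{e_k} e_j, e_i⟩` for the Levi-Civita connection of the left-invariant metric in which
the left-invariant frame `e₁, e₂, e₃` is orthonormal. -/
def connection (k j i : Fin 3) : ℝ :=
  (structureConst k j i + structureConst i k j + structureConst i j k) / 2

/-! ### Maps from a domain of `ℂ` into `SL̃₂`

Tangent vectors of `SL̃₂` are expressed through their coordinates in the left-invariant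
orthonormal frame `e₁, e₂, e₃`; the metric is then the standard dot product. -/

/-- The coordinates in the frame `e₁, e₂, e₃` of the left translate to the unit
`F⁻¹ dF(u)` of the derivative of `F` at `z` along `u`. -/
def velocity (F : ℂ → SLTilde) (z u : ℂ) : Fin 3 → ℝ :=
  coord (((proj (F z))⁻¹ : Matrix.SpecialLinearGroup (Fin 2) ℝ).1 *
    Matrix.of fun i j => fderiv ℝ (fun w => (proj (F w)).1 i j) z u)

/-- The velocity is invariant under left translations, hence so is the metric. -/
lemma velocity_mul_left (g : SLTilde) (F : ℂ → SLTilde) (z u : ℂ)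
    (hF : ∀ i j, DifferentiableAt ℝ (fun w => (proj (F w)).1 i j) z) :
    velocity (fun w => g * F w) z u = velocity F z u := by
  have h : (Matrix.of fun i j => fderiv ℝ (fun w => (proj (g * F w)).1 i j) z u) =
      (proj g).1 * Matrix.of fun i j => fderiv ℝ (fun w => (proj (F w)).1 i j) z u := by
    ext i j
    have he : (fun w => (proj (g * F w)).1 i j) =
        fun w => ∑ k, (proj g).1 i k * (proj (F w)).1 k j := by
      ext w
      rw [map_mul]
      exact Matrix.mul_apply
    rw [Matrix.of_apply, he, fderiv_fun_sum fun k _ => (hF k j).const_mul _]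
    simp [Matrix.mul_apply, fderiv_const_mul (hF _ _)]
  rw [velocity, velocity, h, ← Matrix.mul_assoc, map_mul, mul_inv_rev]
  congr 2
  change ((proj (F z))⁻¹ * (proj g)⁻¹ * proj g).1 = _
  rw [inv_mul_cancel_right]

/-- The conformal factor `e^{2α}` of the induced metric `e^{2α} dz dz̄`. -/
def conformalFactor (F : ℂ → SLTilde) (z : ℂ) : ℝ := velocity F z 1 ⬝ᵥ velocity F z 1

/-- The covariant derivative along `u` of the vector field `∑ Y^i e_i` along `F`. -/
def covDeriv (F : ℂ → SLTilde) (Y : ℂ → Fin 3 → ℝ) (z u : ℂ) : Fin 3 → ℝ := fun i =>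
  fderiv ℝ (fun w => Y w i) z u + ∑ k, ∑ j, velocity F z u k * Y z j * connection k j i

/-- The left translate `F⁻¹(N)` of the unit normal `N` of a conformal immersion, the orientation
of `SL̃₂` being the one in which `e₁, e₂, e₃` is positive. -/
def normal (F : ℂ → SLTilde) (z : ℂ) : Fin 3 → ℝ :=
  (conformalFactor F z)⁻¹ • (velocity F z 1 ⨯₃ velocity F z Complex.I)

/-- The mean curvature (half of the trace of the second fundamental form with respect to the
normal `N`) of a conformal immersion. -/
def meanCurvature (F : ℂ → SLTilde) (z : ℂ) : ℝ :=
  ((covDeriv F (fun w => velocity F w 1) z 1 +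
    covDeriv F (fun w => velocity F w Complex.I) z Complex.I) ⬝ᵥ normal F z) /
    (2 * conformalFactor F z)

/-- The coefficients `Z_k` in `F⁻¹ ∂F = ∑ Z_k e_k`, where `∂ = (∂_x - i ∂_y) / 2`. -/
def zCoeff (F : ℂ → SLTilde) (z : ℂ) (k : Fin 3) : ℂ :=
  ((velocity F z 1 k : ℂ) - Complex.I * (velocity F z Complex.I k : ℂ)) / 2

/-- `(ψ₁, ψ₂)` parametrizes the isotropic vector `Z`. -/
def IsSpinor (Z : Fin 3 → ℂ) (ψ : ℂ × ℂ) : Prop :=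
  Z 0 = Complex.I / 2 * ((starRingEnd ℂ) ψ.2 ^ 2 + ψ.1 ^ 2) ∧
  Z 1 = 1 / 2 * ((starRingEnd ℂ) ψ.2 ^ 2 - ψ.1 ^ 2) ∧
  Z 2 = ψ.1 * (starRingEnd ℂ) ψ.2

/-- A value at `z` of the generating spinor of `F`; for a conformal immersion it exists and is
unique up to a common sign of `ψ₁` and `ψ₂`. -/
def spinor (F : ℂ → SLTilde) (z : ℂ) : ℂ × ℂ := Classical.epsilon (IsSpinor (zCoeff F z))

/-- `∂ = (∂_x - i ∂_y) / 2`. -/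
def wirtinger (h : ℂ → ℂ) (z : ℂ) : ℂ :=
  (fderiv ℝ h z 1 - Complex.I * fderiv ℝ h z Complex.I) / 2

/-- `∂̄ = (∂_x + i ∂_y) / 2`. -/
def wirtingerBar (h : ℂ → ℂ) (z : ℂ) : ℂ :=
  (fderiv ℝ h z 1 + Complex.I * fderiv ℝ h z Complex.I) / 2

/-- `U` and `V` are the potentials on `D` of the Dirac operator of `F`: they are continuous, and
every local generating spinor `ψ` of `F` satisfies the Dirac equation
`∂ψ₂ + U ψ₁ = 0`, `-∂̄ψ₁ + V ψ₂ = 0`. -/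
def IsDiracPotential (F : ℂ → SLTilde) (D : Set ℂ) (U V : ℂ → ℂ) : Prop :=
  ContinuousOn U D ∧ ContinuousOn V D ∧
  ∀ Ω : Set ℂ, IsOpen Ω → Ω ⊆ D → ∀ ψ₁ ψ₂ : ℂ → ℂ,
    ContDiffOn ℝ 1 ψ₁ Ω → ContDiffOn ℝ 1 ψ₂ Ω →
    (∀ z ∈ Ω, IsSpinor (zCoeff F z) (ψ₁ z, ψ₂ z)) →
    ∀ z ∈ Ω, wirtinger ψ₂ z + U z * ψ₁ z = 0 ∧ -wirtingerBar ψ₁ z + V z * ψ₂ z = 0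

end SLTilde

/-! ### Closed oriented surfaces -/

/-- A Riemann surface is a smooth real surface. -/
theorem isManifold_real_of_complex (M : Type*) [TopologicalSpace M] [ChartedSpace ℂ M]
    [IsManifold 𝓘(ℂ) ω M] : IsManifold 𝓘(ℝ, ℂ) ∞ M := by
  refine isManifold_of_contDiffOn 𝓘(ℝ, ℂ) ∞ M fun e e' he he' => ?_
  have h := (contDiffGroupoid ω 𝓘(ℂ)).compatible he he'
  have h1 := ((contDiffGroupoid ω 𝓘(ℂ)).mem_iff_of_eqOnSource (Setoid.refl _)).1 h
  rw [contDiffGroupoid, mem_groupoid_of_pregroupoid] at h1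
  have h2 : ContDiffOn ℂ ω (e.symm.trans e') (e.symm.trans e').source := by
    simpa [contDiffPregroupoid] using h1.1
  simpa using (h2.restrict_scalars ℝ).of_le le_top

/-- A smooth partition of unity on a closed Riemann surface subordinate to its charts. -/
def chartPartition (M : Type*) [TopologicalSpace M] [T2Space M] [CompactSpace M]
    [ChartedSpace ℂ M] [IsManifold 𝓘(ℂ) ω M] :
    SmoothPartitionOfUnity M 𝓘(ℝ, ℂ) M Set.univ :=
  haveI := isManifold_real_of_complex M
  (SmoothPartitionOfUnity.exists_isSubordinate_chartAt_source 𝓘(ℝ, ℂ) M).choose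

theorem chartPartition_isSubordinate (M : Type*) [TopologicalSpace M] [T2Space M] [CompactSpace M]
    [ChartedSpace ℂ M] [IsManifold 𝓘(ℂ) ω M] :
    (chartPartition M).IsSubordinate fun p => (chartAt ℂ p).source :=
  haveI := isManifold_real_of_complex M
  (SmoothPartitionOfUnity.exists_isSubordinate_chartAt_source 𝓘(ℝ, ℂ) M).choose_spec

/-- The integral over a closed Riemann surface `M` of the `2`-form which is
`h e z dx ∧ dy = h e z (i dz ∧ dz̄ / 2)` in the chart `e` with coordinate `z = x + i y`. -/
def surfaceIntegral {M : Type*} [TopologicalSpace M] [T2Space M] [CompactSpace M]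
    [ChartedSpace ℂ M] [IsManifold 𝓘(ℂ) ω M] {E : Type*} [NormedAddCommGroup E] [NormedSpace ℝ E]
    (h : OpenPartialHomeomorph M ℂ → ℂ → E) : E :=
  ∑ᶠ p : M, ∫ z in (chartAt ℂ p).target,
    chartPartition M p ((chartAt ℂ p).symm z) • h (chartAt ℂ p) z

/-- `f` is a smooth immersion, and the charts of `M` are conformal parameters for the
metric induced by `f`. -/
structure IsConformalImmersion {M : Type*} [TopologicalSpace M] [ChartedSpace ℂ M]
    (f : M → SLTilde) : Prop where
  smooth : ContMDiff 𝓘(ℝ, ℂ) 𝓘(ℝ, ℝ × ℂ) ∞ f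
  immersion : ∀ p : M, Function.Injective (mfderiv 𝓘(ℝ, ℂ) 𝓘(ℝ, ℝ × ℂ) f p)
  conformal : ∀ e ∈ atlas ℂ M, ∀ z ∈ e.target,
    SLTilde.velocity (f ∘ e.symm) z 1 ⬝ᵥ SLTilde.velocity (f ∘ e.symm) z 1 =
      SLTilde.velocity (f ∘ e.symm) z Complex.I ⬝ᵥ SLTilde.velocity (f ∘ e.symm) z Complex.I ∧
    SLTilde.velocity (f ∘ e.symm) z 1 ⬝ᵥ SLTilde.velocity (f ∘ e.symm) z Complex.I = 0

/-- The potentials `(U, V)` of the Dirac operator of a surface in the chart `e`. -/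
def diracPotentials {M : Type*} [TopologicalSpace M] (f : M → SLTilde)
    (e : OpenPartialHomeomorph M ℂ) : (ℂ → ℂ) × (ℂ → ℂ) :=
  Classical.epsilon fun P : (ℂ → ℂ) × (ℂ → ℂ) =>
    SLTilde.IsDiracPotential (f ∘ e.symm) e.target P.1 P.2

/-- The energy `E(M) = ∫_M U V dx ∧ dy` of a closed surface. -/
def energy {M : Type*} [TopologicalSpace M] [T2Space M] [CompactSpace M]
    [ChartedSpace ℂ M] [IsManifold 𝓘(ℂ) ω M] (f : M → SLTilde) : ℂ :=
  surfaceIntegral fun (e : OpenPartialHomeomorph M ℂ) z =>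
    (diracPotentials f e).1 z * (diracPotentials f e).2 z

end

/-!
Write `ψ` for a generating spinor. The tension field of a conformal immersion is
`2 H (f_x × f_y)` in the frame `e₁, e₂, e₃`, while the Maurer–Cartan equation gives the
skew-symmetric part of the derivative of `f⁻¹ df`. Together they determine `∂̄Z`, and hence the
Dirac equation for `ψ`, with potentials
`U = H / 2 (|ψ₁|² + |ψ₂|²) + i (1/2 |ψ₁|² - 3/4 |ψ₂|²)` and
`V = H / 2 (|ψ₁|² + |ψ₂|²) + i (3/4 |ψ₁|² - 1/2 |ψ₂|²)`.
They are unique because `Z₃ = ψ₁ ψ̄₂` vanishes on no open set, and the real part of `U V` is the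
integrand of the energy formula. The imaginary part of `U V` is `-5/4 Re ∂̄Z₃`; since `Z₃ dz` is a
global form of type `(1, 0)`, the form `∂̄Z₃ dz̄ ∧ dz` is exact and its integral vanishes.
-/

namespace SLTilde

/-! ### The Maurer–Cartan equation -/

section MatrixCalculus

variable {E : Type*} [NormedAddCommGroup E] [NormedSpace ℝ E] {l m n : Type*}

/-- The derivative at `z` along `u` of a map into matrices.  It is taken entry by entry, since
spaces of matrices carry no canonical norm. -/
noncomputable def matrixDeriv (G : E → Matrix m n ℝ) (z u : E) : Matrix m n ℝ :=
  Matrix.of fun i j => fderiv ℝ (fun w => G w i j) z u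

lemma matrixDeriv_apply (G : E → Matrix m n ℝ) (z u : E) (i : m) (j : n) :
    matrixDeriv G z u i j = fderiv ℝ (fun w => G w i j) z u := rfl

lemma matrixDeriv_mul [Fintype m] {A : E → Matrix l m ℝ} {B : E → Matrix m n ℝ} {z : E}
    (hA : ∀ i j, DifferentiableAt ℝ (fun w => A w i j) z)
    (hB : ∀ i j, DifferentiableAt ℝ (fun w => B w i j) z) (u : E) :
    matrixDeriv (fun w => A w * B w) z u = matrixDeriv A z u * B z + A z * matrixDeriv B z u := by
  ext i j
  simp only [matrixDeriv_apply, Matrix.add_apply, Matrix.mul_apply]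
  rw [fderiv_fun_sum fun k _ => (hA i k).fun_mul (hB k j), sum_apply,
    ← Finset.sum_add_distrib]
  refine Finset.sum_congr rfl fun k _ => ?_
  rw [fderiv_fun_mul (hA i k) (hB k j)]
  simp only [_root_.add_apply, _root_.smul_apply, smul_eq_mul]
  ring

lemma contDiffAt_matrixDeriv {G : E → Matrix m n ℝ} {z : E} {r s : WithTop ℕ∞}
    (hG : ∀ i j, ContDiffAt ℝ s (fun w => G w i j) z) (hr : r + 1 ≤ s) (u : E) (i : m) (j : n) :
    ContDiffAt ℝ r (fun w => matrixDeriv G w u i j) z :=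
  ((hG i j).fderiv_right hr).clm_apply contDiffAt_const

lemma matrixDeriv_comm {G : E → Matrix m n ℝ} {z : E}
    (hG : ∀ i j, ContDiffAt ℝ 2 (fun w => G w i j) z) (u v : E) :
    matrixDeriv (fun w => matrixDeriv G w v) z u =
      matrixDeriv (fun w => matrixDeriv G w u) z v := by
  ext i j
  have hd : DifferentiableAt ℝ (fderiv ℝ fun w => G w i j) z :=
    ((hG i j).fderiv_right (m := 1) (by norm_num)).differentiableAt one_ne_zero
  have hsymm := (hG i j).isSymmSndFDerivAt (by simp)
  simp only [matrixDeriv_apply]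
  rw [fderiv_clm_apply hd (differentiableAt_const v),
    fderiv_clm_apply hd (differentiableAt_const u)]
  simpa using hsymm u v

variable [Fintype n] [DecidableEq n] {G K : E → Matrix n n ℝ} {z : E}

lemma matrixDeriv_leftInverse (hG : ∀ i j, DifferentiableAt ℝ (fun w => G w i j) z)
    (hK : ∀ i j, DifferentiableAt ℝ (fun w => K w i j) z) (hKG : ∀ w, K w * G w = 1) (u : E) :
    matrixDeriv K z u = -(K z * matrixDeriv G z u * K z) := by
  have hconst : matrixDeriv (fun w => K w * G w) z u = 0 := by
    ext i j
    simp only [hKG, matrixDeriv_apply, fderiv_const_apply, zero_apply,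
      Matrix.zero_apply]
  rw [matrixDeriv_mul hK hG] at hconst
  rw [← Matrix.neg_mul, ← eq_neg_of_add_eq_zero_left hconst, Matrix.mul_assoc,
    mul_eq_one_comm.1 (hKG z), Matrix.mul_one]

theorem matrixDeriv_maurerCartan (hG : ∀ i j, ContDiffAt ℝ 2 (fun w => G w i j) z)
    (hK : ∀ i j, DifferentiableAt ℝ (fun w => K w i j) z) (hKG : ∀ w, K w * G w = 1) (u v : E) :
    matrixDeriv (fun w => K w * matrixDeriv G w v) z u -
        matrixDeriv (fun w => K w * matrixDeriv G w u) z v =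
      -(K z * matrixDeriv G z u * (K z * matrixDeriv G z v) -
        K z * matrixDeriv G z v * (K z * matrixDeriv G z u)) := by
  have hG' : ∀ i j, DifferentiableAt ℝ (fun w => G w i j) z := fun i j =>
    (hG i j).differentiableAt two_ne_zero
  have hdG : ∀ u i j, DifferentiableAt ℝ (fun w => matrixDeriv G w u i j) z := fun u i j =>
    (contDiffAt_matrixDeriv hG (by norm_num) u i j).differentiableAt one_ne_zero
  rw [matrixDeriv_mul hK (hdG v), matrixDeriv_mul hK (hdG u), matrixDeriv_comm hG u v,
    matrixDeriv_leftInverse hG' hK hKG, matrixDeriv_leftInverse hG' hK hKG]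
  noncomm_ring

end MatrixCalculus

lemma coord_add (X Y : Matrix (Fin 2) (Fin 2) ℝ) : coord (X + Y) = coord X + coord Y := by
  ext k
  fin_cases k <;> simp [coord] <;> ring

lemma coord_smul (r : ℝ) (X : Matrix (Fin 2) (Fin 2) ℝ) : coord (r • X) = r • coord X := by
  ext k
  fin_cases k <;> simp [coord] <;> ring

lemma coord_neg (X : Matrix (Fin 2) (Fin 2) ℝ) : coord (-X) = -coord X := by
  simpa using coord_smul (-1) X

lemma coord_sub (X Y : Matrix (Fin 2) (Fin 2) ℝ) : coord (X - Y) = coord X - coord Y := by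
  rw [sub_eq_add_neg, coord_add, coord_neg, sub_eq_add_neg]

/-- The Lie bracket of `sl(2, ℝ)` in the coordinates of the basis `e₁, e₂, e₃`. -/
noncomputable def lieBracket (x y : Fin 3 → ℝ) : Fin 3 → ℝ := ![1 / 2, 1 / 2, -2] * (x ⨯₃ y)

lemma coord_commutator (X Y : Matrix (Fin 2) (Fin 2) ℝ) :
    coord (X * Y - Y * X) = lieBracket (coord X) (coord Y) := by
  ext k
  fin_cases k <;>
    simp [coord, lieBracket, cross_apply, Matrix.mul_apply, Fin.sum_univ_two] <;> ring

section CoordDeriv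

variable {E : Type*} [NormedAddCommGroup E] [NormedSpace ℝ E]
  {X : E → Matrix (Fin 2) (Fin 2) ℝ} {z : E}

lemma contDiffAt_coord {r : WithTop ℕ∞} (hX : ∀ i j, ContDiffAt ℝ r (fun w => X w i j) z) :
    ContDiffAt ℝ r (fun w => coord (X w)) z := by
  refine contDiffAt_pi.2 fun k => ?_
  fin_cases k
  · exact (hX 0 0).sub (hX 1 1)
  · exact (hX 0 1).add (hX 1 0)
  · exact contDiffAt_const.mul ((hX 1 0).sub (hX 0 1))

lemma fderiv_coord (hX : ∀ i j, DifferentiableAt ℝ (fun w => X w i j) z) (u : E) :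
    fderiv ℝ (fun w => coord (X w)) z u = coord (matrixDeriv X z u) := by
  have hdiff : DifferentiableAt ℝ (fun w => coord (X w)) z := by
    refine differentiableAt_pi.2 fun k => ?_
    fin_cases k
    · exact (hX 0 0).sub (hX 1 1)
    · exact (hX 0 1).add (hX 1 0)
    · exact ((hX 1 0).sub (hX 0 1)).const_mul 2
  ext k
  refine (congrArg (· u) (fderiv_apply hdiff k)).symm.trans ?_
  fin_cases k
  · exact congrArg (· u) (fderiv_fun_sub (hX 0 0) (hX 1 1))
  · exact congrArg (· u) (fderiv_fun_add (hX 0 1) (hX 1 0))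
  · exact congrArg (· u) (((hX 1 0).hasFDerivAt.fun_sub (hX 0 1).hasFDerivAt).const_mul 2).fderiv

end CoordDeriv

/-- The pullback by `F` of the Maurer–Cartan form: the matrix `F⁻¹ dF(u)` at `z`. -/
noncomputable def maurerCartanForm (F : ℂ → SLTilde) (z u : ℂ) : Matrix (Fin 2) (Fin 2) ℝ :=
  ((proj (F z))⁻¹).1 * matrixDeriv (fun w => (proj (F w)).1) z u

/-- Smoothness of `F` at `z`, expressed by the entries of the matrices of `SL(2, ℝ)` below `F`. -/
def SmoothAt (F : ℂ → SLTilde) (z : ℂ) : Prop :=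
  ∀ i j, ContDiffAt ℝ ∞ (fun w => (proj (F w)).1 i j) z

variable {F : ℂ → SLTilde} {z : ℂ}

lemma velocity_eq_coord (F : ℂ → SLTilde) (z u : ℂ) :
    velocity F z u = coord (maurerCartanForm F z u) := rfl

lemma velocity_eq_re_smul_add_im_smul (F : ℂ → SLTilde) (z u : ℂ) :
    velocity F z u = u.re • velocity F z 1 + u.im • velocity F z Complex.I := by
  have hu : u = u.re • (1 : ℂ) + u.im • Complex.I := by simp [Complex.re_add_im]
  have hderiv : matrixDeriv (fun w => (proj (F w)).1) z u =
      u.re • matrixDeriv (fun w => (proj (F w)).1) z 1 +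
        u.im • matrixDeriv (fun w => (proj (F w)).1) z Complex.I := by
    ext i j
    simp only [matrixDeriv_apply, Matrix.add_apply, Matrix.smul_apply]
    conv_lhs => rw [hu, map_add, map_smul, map_smul]
  simp only [velocity_eq_coord, maurerCartanForm, hderiv, Matrix.mul_add, Matrix.mul_smul,
    coord_add, coord_smul]

lemma velocity_congr {F' : ℂ → SLTilde} (hF : F =ᶠ[nhds z] F') (u : ℂ) :
    velocity F z u = velocity F' z u := by
  have hentry : ∀ i j, fderiv ℝ (fun w => (proj (F w)).1 i j) z =
      fderiv ℝ (fun w => (proj (F' w)).1 i j) z := fun i j =>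
    (hF.fun_comp fun g => (proj g).1 i j).fderiv_eq
  simp only [velocity, hentry, hF.self_of_nhds]

lemma SmoothAt.differentiableAt (h : SmoothAt F z) (i j : Fin 2) :
    DifferentiableAt ℝ (fun w => (proj (F w)).1 i j) z :=
  (h i j).differentiableAt (by simp)

lemma SmoothAt.velocity_comp {φ : ℂ → ℂ} {φ' : ℂ →L[ℝ] ℂ} (h : SmoothAt F (φ z))
    (hφ : HasFDerivAt φ φ' z) (u : ℂ) : velocity (F ∘ φ) z u = velocity F (φ z) (φ' u) := by
  have hentry : ∀ i j, fderiv ℝ (fun w => (proj ((F ∘ φ) w)).1 i j) z u =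
      fderiv ℝ (fun w => (proj (F w)).1 i j) (φ z) (φ' u) := fun i j =>
    congrArg (· u) ((h.differentiableAt i j).hasFDerivAt.comp z hφ).fderiv
  simp only [velocity, hentry]
  rfl

lemma SmoothAt.contDiffAt_inv (h : SmoothAt F z) (i j : Fin 2) :
    ContDiffAt ℝ ∞ (fun w => ((proj (F w))⁻¹).1 i j) z := by
  simp only [Matrix.SpecialLinearGroup.coe_inv, Matrix.adjugate_fin_two]
  fin_cases i <;> fin_cases j
  exacts [h 1 1, (h 0 1).neg, (h 1 0).neg, h 0 0]

lemma SmoothAt.contDiffAt_maurerCartanForm (h : SmoothAt F z) (u : ℂ) (i j : Fin 2) :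
    ContDiffAt ℝ ∞ (fun w => maurerCartanForm F w u i j) z := by
  simp only [maurerCartanForm, Matrix.mul_apply]
  exact ContDiffAt.sum fun k _ =>
    (h.contDiffAt_inv i k).mul (contDiffAt_matrixDeriv h (by simp) u k j)

lemma SmoothAt.contDiffAt_velocity (h : SmoothAt F z) (u : ℂ) :
    ContDiffAt ℝ ∞ (fun w => velocity F w u) z :=
  contDiffAt_coord (h.contDiffAt_maurerCartanForm u)

lemma SmoothAt.differentiableAt_velocity (h : SmoothAt F z) (u : ℂ) :
    DifferentiableAt ℝ (fun w => velocity F w u) z :=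
  (h.contDiffAt_velocity u).differentiableAt (by simp)

theorem SmoothAt.fderiv_velocity_sub (h : SmoothAt F z) (u v : ℂ) :
    fderiv ℝ (fun w => velocity F w v) z u - fderiv ℝ (fun w => velocity F w u) z v =
      -lieBracket (velocity F z u) (velocity F z v) := by
  have hdiff : ∀ u i j, DifferentiableAt ℝ (fun w => maurerCartanForm F w u i j) z := fun u i j =>
    (h.contDiffAt_maurerCartanForm u i j).differentiableAt (by simp)
  have hinv : ∀ w, ((proj (F w))⁻¹).1 * (proj (F w)).1 = 1 := fun w =>
    congrArg Subtype.val (inv_mul_cancel (proj (F w)))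
  simp only [velocity_eq_coord]
  rw [fderiv_coord (hdiff v), fderiv_coord (hdiff u), ← coord_sub, ← coord_commutator, ← coord_neg]
  exact congrArg coord (matrixDeriv_maurerCartan (fun i j => contDiffAt_infty.1 (h i j) 2)
    (fun i j => (h.contDiffAt_inv i j).differentiableAt (by simp)) hinv u v)

/-! ### The Levi-Civita connection and the tension of a conformal immersion -/

/-- The covariant derivative `∇_x y` of left-invariant vector fields, in the frame
`e₁, e₂, e₃`. -/
noncomputable def leviCivita (x y : Fin 3 → ℝ) : Fin 3 → ℝ :=
  fun i => ∑ k, ∑ j, x k * y j * connection k j i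

lemma leviCivita_eq (x y : Fin 3 → ℝ) :
    leviCivita x y = ![-(x 1 * y 2) - 3 / 2 * (x 2 * y 1), x 0 * y 2 + 3 / 2 * (x 2 * y 0),
      x 1 * y 0 - x 0 * y 1] := by
  ext i
  fin_cases i <;>
    simp [leviCivita, Fin.sum_univ_three, connection, structureConst, coord, basis,
      Matrix.mul_apply] <;> ring

lemma leviCivita_sub (x y : Fin 3 → ℝ) : leviCivita x y - leviCivita y x = lieBracket x y := by
  ext i
  fin_cases i <;> simp [leviCivita_eq, lieBracket, cross_apply] <;> ring

lemma leviCivita_dotProduct_add (x y y' : Fin 3 → ℝ) :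
    leviCivita x y ⬝ᵥ y' + y ⬝ᵥ leviCivita x y' = 0 := by
  simp only [leviCivita_eq, Matrix.vec3_dotProduct, Matrix.cons_val]
  ring

lemma covDeriv_eq {Y : ℂ → Fin 3 → ℝ} (hY : DifferentiableAt ℝ Y z) (u : ℂ) :
    covDeriv F Y z u = fderiv ℝ Y z u + leviCivita (velocity F z u) (Y z) := by
  ext i
  simp only [covDeriv, fderiv_apply hY, ContinuousLinearMap.comp_apply,
    ContinuousLinearMap.proj_apply, leviCivita, Pi.add_apply]

lemma SmoothAt.covDeriv_velocity_comm (h : SmoothAt F z) (u v : ℂ) :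
    covDeriv F (fun w => velocity F w v) z u = covDeriv F (fun w => velocity F w u) z v := by
  have hmc := h.fderiv_velocity_sub u v
  rw [← leviCivita_sub, sub_eq_iff_eq_add] at hmc
  rw [covDeriv_eq (h.differentiableAt_velocity v), covDeriv_eq (h.differentiableAt_velocity u), hmc]
  abel

lemma fderiv_dotProduct (F : ℂ → SLTilde) {Y Y' : ℂ → Fin 3 → ℝ} (hY : DifferentiableAt ℝ Y z)
    (hY' : DifferentiableAt ℝ Y' z) (u : ℂ) :
    fderiv ℝ (fun w => Y w ⬝ᵥ Y' w) z u =
      covDeriv F Y z u ⬝ᵥ Y' z + Y z ⬝ᵥ covDeriv F Y' z u := by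
  have hprod : fderiv ℝ (fun w => Y w ⬝ᵥ Y' w) z u =
      fderiv ℝ Y z u ⬝ᵥ Y' z + Y z ⬝ᵥ fderiv ℝ Y' z u := by
    simp only [dotProduct]
    rw [fderiv_fun_sum fun k _ =>
        (differentiableAt_pi.1 hY k).fun_mul (differentiableAt_pi.1 hY' k),
      sum_apply, ← Finset.sum_add_distrib]
    refine Finset.sum_congr rfl fun k _ => ?_
    rw [fderiv_fun_mul (differentiableAt_pi.1 hY k) (differentiableAt_pi.1 hY' k),
      fderiv_apply hY, fderiv_apply hY']
    simp only [_root_.add_apply, _root_.smul_apply, ContinuousLinearMap.comp_apply,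
      ContinuousLinearMap.proj_apply, smul_eq_mul]
    ring
  rw [covDeriv_eq hY, covDeriv_eq hY', hprod, add_dotProduct, dotProduct_add]
  linear_combination -leviCivita_dotProduct_add (velocity F z u) (Y z) (Y' z)

/-- `F` is a smooth immersion of the open set `D`, and `x`, `y` are conformal parameters for the
induced metric. -/
structure IsConformalOn (F : ℂ → SLTilde) (D : Set ℂ) : Prop where
  isOpen : IsOpen D
  smoothAt : ∀ z ∈ D, SmoothAt F z
  sq_eq : ∀ z ∈ D, velocity F z 1 ⬝ᵥ velocity F z 1 =
    velocity F z Complex.I ⬝ᵥ velocity F z Complex.I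
  orthogonal : ∀ z ∈ D, velocity F z 1 ⬝ᵥ velocity F z Complex.I = 0
  velocity_ne_zero : ∀ z ∈ D, velocity F z 1 ≠ 0

/-- The tension of `F` in the flat metric `dx² + dy²`: the trace of its second fundamental
form `∇dF`. -/
noncomputable def tension (F : ℂ → SLTilde) (z : ℂ) : Fin 3 → ℝ :=
  covDeriv F (fun w => velocity F w 1) z 1 +
    covDeriv F (fun w => velocity F w Complex.I) z Complex.I

variable {D : Set ℂ}

lemma IsConformalOn.covDeriv_dotProduct_of_sq_eq (h : IsConformalOn F D) (hz : z ∈ D) (u : ℂ) :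
    covDeriv F (fun w => velocity F w 1) z u ⬝ᵥ velocity F z 1 =
      covDeriv F (fun w => velocity F w Complex.I) z u ⬝ᵥ velocity F z Complex.I := by
  have hd := (h.smoothAt z hz).differentiableAt_velocity
  have heq := Filter.EventuallyEq.fderiv_eq (𝕜 := ℝ) (Filter.eventuallyEq_of_mem
    (h.isOpen.mem_nhds hz) h.sq_eq)
  have happly := congrArg (fun A : ℂ →L[ℝ] ℝ => A u) heq
  simp only [fderiv_dotProduct F (hd 1) (hd 1), fderiv_dotProduct F (hd Complex.I) (hd Complex.I),
    dotProduct_comm (velocity F z 1), dotProduct_comm (velocity F z Complex.I)] at happly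
  linarith

lemma IsConformalOn.covDeriv_dotProduct_of_orthogonal (h : IsConformalOn F D) (hz : z ∈ D)
    (u : ℂ) :
    covDeriv F (fun w => velocity F w 1) z u ⬝ᵥ velocity F z Complex.I =
      -(covDeriv F (fun w => velocity F w Complex.I) z u ⬝ᵥ velocity F z 1) := by
  have hd := (h.smoothAt z hz).differentiableAt_velocity
  have heq := Filter.EventuallyEq.fderiv_eq (𝕜 := ℝ) (Filter.eventuallyEq_of_mem
    (h.isOpen.mem_nhds hz) h.orthogonal)
  have happly := congrArg (fun A : ℂ →L[ℝ] ℝ => A u) heq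
  simp only [fderiv_dotProduct F (hd 1) (hd Complex.I), fderiv_const_apply, zero_apply,
    dotProduct_comm (velocity F z 1)] at happly
  linarith

lemma IsConformalOn.tension_dotProduct_velocity_one (h : IsConformalOn F D) (hz : z ∈ D) :
    tension F z ⬝ᵥ velocity F z 1 = 0 := by
  rw [tension, add_dotProduct, h.covDeriv_dotProduct_of_sq_eq hz,
    (h.smoothAt z hz).covDeriv_velocity_comm 1 Complex.I, h.covDeriv_dotProduct_of_orthogonal hz,
    neg_add_cancel]

lemma IsConformalOn.tension_dotProduct_velocity_I (h : IsConformalOn F D) (hz : z ∈ D) :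
    tension F z ⬝ᵥ velocity F z Complex.I = 0 := by
  rw [tension, add_dotProduct, ← h.covDeriv_dotProduct_of_sq_eq hz,
    (h.smoothAt z hz).covDeriv_velocity_comm Complex.I 1, h.covDeriv_dotProduct_of_orthogonal hz,
    neg_add_cancel]

lemma smul_eq_smul_cross {R : Type*} [CommRing R] {t x y : Fin 3 → R} (hx : t ⬝ᵥ x = 0)
    (hy : t ⬝ᵥ y = 0) :
    ((x ⨯₃ y) ⬝ᵥ (x ⨯₃ y)) • t = (t ⬝ᵥ (x ⨯₃ y)) • (x ⨯₃ y) := by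
  have hcross : t ⨯₃ (x ⨯₃ y) = 0 := by
    rw [cross_cross_eq_smul_sub_smul', hy, dotProduct_comm x, hx, zero_smul, zero_smul, sub_zero]
  have htriple := cross_cross_eq_smul_sub_smul' (x ⨯₃ y) t (x ⨯₃ y)
  rwa [hcross, map_zero, eq_comm, sub_eq_zero] at htriple

lemma IsConformalOn.conformalFactor_pos (h : IsConformalOn F D) (hz : z ∈ D) :
    0 < conformalFactor F z :=
  (Finset.sum_nonneg fun k _ => mul_self_nonneg (velocity F z 1 k)).lt_of_ne'
    (dotProduct_self_eq_zero.not.2 (h.velocity_ne_zero z hz))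

theorem IsConformalOn.tension_eq (h : IsConformalOn F D) (hz : z ∈ D) :
    tension F z = (2 * meanCurvature F z) • (velocity F z 1 ⨯₃ velocity F z Complex.I) := by
  have hpos := h.conformalFactor_pos hz
  have hsq : (velocity F z 1 ⨯₃ velocity F z Complex.I) ⬝ᵥ
      (velocity F z 1 ⨯₃ velocity F z Complex.I) = conformalFactor F z ^ 2 := by
    rw [cross_dot_cross, ← h.sq_eq z hz, h.orthogonal z hz, zero_mul, sub_zero, sq, conformalFactor]
  have hnormal := smul_eq_smul_cross (h.tension_dotProduct_velocity_one hz)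
    (h.tension_dotProduct_velocity_I hz)
  have hH : conformalFactor F z ^ 2 * (2 * meanCurvature F z) =
      tension F z ⬝ᵥ (velocity F z 1 ⨯₃ velocity F z Complex.I) := by
    rw [meanCurvature, normal, dotProduct_smul, smul_eq_mul, tension]
    field_simp
  rw [hsq, ← hH, mul_smul] at hnormal
  exact smul_right_injective _ (pow_pos hpos 2).ne' hnormal

lemma SmoothAt.continuousAt_covDeriv_velocity (h : SmoothAt F z) (u v : ℂ) :
    ContinuousAt (fun w => covDeriv F (fun w => velocity F w v) w u) z := by
  have hc : ∀ u k, ContinuousAt (fun w => velocity F w u k) z := fun u k =>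
    continuousAt_pi.1 (h.contDiffAt_velocity u).continuousAt k
  refine continuousAt_pi.2 fun i => ContinuousAt.add ?_ ?_
  · exact (((contDiffAt_pi.1 (h.contDiffAt_velocity v) i).fderiv_right
      (m := 0) (by simp)).continuousAt).clm_apply continuousAt_const
  · exact tendsto_finsetSum _ fun k _ => tendsto_finsetSum _ fun j _ =>
      ((hc u k).mul (hc v j)).mul continuousAt_const

lemma IsConformalOn.continuousOn_meanCurvature (h : IsConformalOn F D) :
    ContinuousOn (meanCurvature F) D := by
  intro z hz
  have hs := h.smoothAt z hz
  have hv := fun u => (hs.contDiffAt_velocity u).continuousAt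
  have hdot : Continuous fun p : (Fin 3 → ℝ) × (Fin 3 → ℝ) => p.1 ⬝ᵥ p.2 :=
    continuous_fst.dotProduct continuous_snd
  have hcross : Continuous fun p : (Fin 3 → ℝ) × (Fin 3 → ℝ) => p.1 ⨯₃ p.2 := by
    refine continuous_pi fun k => ?_
    simp only [cross_apply]
    fin_cases k <;> dsimp <;> fun_prop
  have hfactor : ContinuousAt (conformalFactor F) z := hdot.continuousAt.comp₂ (hv 1) (hv 1)
  have hne := (h.conformalFactor_pos hz).ne'
  have hnormal : ContinuousAt (normal F) z :=
    (hfactor.inv₀ hne).smul (hcross.continuousAt.comp₂ (hv 1) (hv Complex.I))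
  have htension : ContinuousAt (tension F) z :=
    (hs.continuousAt_covDeriv_velocity 1 1).add (hs.continuousAt_covDeriv_velocity _ _)
  exact ((hdot.continuousAt.comp₂ htension hnormal).div (continuousAt_const.mul hfactor)
    (mul_ne_zero two_ne_zero hne)).continuousWithinAt

/-! ### Generating spinors -/

section Wirtinger

variable {f g : ℂ → ℂ}

lemma wirtingerBar_mul (hf : DifferentiableAt ℝ f z) (hg : DifferentiableAt ℝ g z) :
    wirtingerBar (fun w => f w * g w) z = f z * wirtingerBar g z + wirtingerBar f z * g z := by
  simp only [wirtingerBar, fderiv_fun_mul hf hg, _root_.add_apply, _root_.smul_apply, smul_eq_mul]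
  ring

lemma wirtingerBar_const_mul_add (hf : DifferentiableAt ℝ f z) (hg : DifferentiableAt ℝ g z)
    (a b : ℂ) :
    wirtingerBar (fun w => a * f w + b * g w) z = a * wirtingerBar f z + b * wirtingerBar g z := by
  simp only [wirtingerBar, fderiv_fun_add (hf.const_mul a) (hg.const_mul b), fderiv_const_mul hf,
    fderiv_const_mul hg, _root_.add_apply, _root_.smul_apply, smul_eq_mul]
  ring

lemma wirtingerBar_conj (f : ℂ → ℂ) (z : ℂ) :
    wirtingerBar (fun w => (starRingEnd ℂ) (f w)) z = (starRingEnd ℂ) (wirtinger f z) := by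
  have hcomp : fderiv ℝ (fun w => (starRingEnd ℂ) (f w)) z =
      (Complex.conjCLE : ℂ →L[ℝ] ℂ) ∘L fderiv ℝ f z := Complex.conjCLE.comp_fderiv
  simp [wirtingerBar, wirtinger, hcomp, Complex.conj_ofNat]

lemma wirtingerBar_congr (h : f =ᶠ[nhds z] g) : wirtingerBar f z = wirtingerBar g z := by
  rw [wirtingerBar, wirtingerBar, h.fderiv_eq]

lemma wirtingerBar_comp {φ : ℂ → ℂ} {c : ℂ} (hf : DifferentiableAt ℝ f (φ z))
    (hφ : HasDerivAt φ c z) :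
    wirtingerBar (f ∘ φ) z = (starRingEnd ℂ) c * wirtingerBar f (φ z) := by
  have hreal : ∀ u : ℂ, fderiv ℝ f (φ z) u =
      u.re * fderiv ℝ f (φ z) 1 + u.im * fderiv ℝ f (φ z) Complex.I := fun u => by
    conv_lhs => rw [show u = u.re • (1 : ℂ) + u.im • Complex.I by simp [Complex.re_add_im]]
    rw [map_add, map_smul, map_smul, Complex.real_smul, Complex.real_smul]
  have hone := hreal c
  have hI := hreal (c * Complex.I)
  simp only [Complex.mul_re, Complex.mul_im, Complex.I_re, Complex.I_im, mul_zero, mul_one,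
    zero_sub, add_zero, Complex.ofReal_neg] at hI
  have hconj : (starRingEnd ℂ) c = c.re - c.im * Complex.I := by
    apply Complex.ext <;> simp
  rw [wirtingerBar, (hf.hasFDerivAt.comp z hφ.complexToReal_fderiv).fderiv, wirtingerBar]
  simp only [ContinuousLinearMap.comp_apply, _root_.smul_apply, one_apply_eq_self, smul_eq_mul,
    mul_one, hone, hI, hconj]
  linear_combination (c.im * fderiv ℝ f (φ z) Complex.I / 2) * Complex.I_sq

lemma continuousOn_wirtingerBar {D : Set ℂ} (hD : IsOpen D) (hf : ContDiffOn ℝ 1 f D) :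
    ContinuousOn (wirtingerBar f) D := by
  have hcont : ∀ u, ContinuousOn (fun z => fderiv ℝ f z u) D := fun u =>
    (hf.continuousOn_fderiv_of_isOpen hD le_rfl).clm_apply continuousOn_const
  exact ((hcont 1).add (continuousOn_const.mul (hcont Complex.I))).div_const 2

end Wirtinger

lemma velocity_one_eq_re (F : ℂ → SLTilde) (z : ℂ) (k : Fin 3) :
    velocity F z 1 k = 2 * (zCoeff F z k).re := by
  simp [zCoeff]
  ring

lemma velocity_I_eq_im (F : ℂ → SLTilde) (z : ℂ) (k : Fin 3) :
    velocity F z Complex.I k = -2 * (zCoeff F z k).im := by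
  simp [zCoeff]
  ring

lemma zCoeff_congr {F' : ℂ → SLTilde} (hF : F =ᶠ[nhds z] F') (k : Fin 3) :
    zCoeff F z k = zCoeff F' z k := by
  simp only [zCoeff, velocity_congr hF]

lemma SmoothAt.zCoeff_comp {φ : ℂ → ℂ} {c : ℂ} (h : SmoothAt F (φ z)) (hφ : HasDerivAt φ c z)
    (k : Fin 3) : zCoeff (F ∘ φ) z k = c * zCoeff F (φ z) k := by
  have hvel : ∀ u, velocity (F ∘ φ) z u =
      (c * u).re • velocity F (φ z) 1 + (c * u).im • velocity F (φ z) Complex.I := fun u =>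
    (h.velocity_comp hφ.complexToReal_fderiv u).trans
      (velocity_eq_re_smul_add_im_smul F (φ z) (c * u))
  apply Complex.ext <;> simp [zCoeff, hvel] <;> ring

lemma SmoothAt.contDiffAt_zCoeff (h : SmoothAt F z) (k : Fin 3) :
    ContDiffAt ℝ ∞ (fun w => zCoeff F w k) z := by
  have hv : ∀ u, ContDiffAt ℝ ∞ (fun w => (velocity F w u k : ℂ)) z := fun u =>
    Complex.ofRealCLM.contDiff.contDiffAt.comp z (contDiffAt_pi.1 (h.contDiffAt_velocity u) k)
  exact ((hv 1).sub (contDiffAt_const.mul (hv Complex.I))).div_const 2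

lemma SmoothAt.differentiableAt_zCoeff (h : SmoothAt F z) (k : Fin 3) :
    DifferentiableAt ℝ (fun w => zCoeff F w k) z :=
  (h.contDiffAt_zCoeff k).differentiableAt (by simp)

lemma SmoothAt.wirtingerBar_zCoeff (h : SmoothAt F z) (k : Fin 3) :
    wirtingerBar (fun w => zCoeff F w k) z =
      (((fderiv ℝ (fun w => velocity F w 1) z 1 +
          fderiv ℝ (fun w => velocity F w Complex.I) z Complex.I) k : ℝ) +
        Complex.I * ((fderiv ℝ (fun w => velocity F w 1) z Complex.I -
          fderiv ℝ (fun w => velocity F w Complex.I) z 1) k : ℝ)) / 4 := by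
  have hd : ∀ u, HasFDerivAt (fun w => (velocity F w u k : ℂ))
      (Complex.ofRealCLM ∘L fderiv ℝ (fun w => velocity F w u k) z) z := fun u =>
    Complex.ofRealCLM.hasFDerivAt.comp z
      (differentiableAt_pi.1 (h.differentiableAt_velocity u) k).hasFDerivAt
  have hZ : (fun w => zCoeff F w k) = fun w =>
      1 / 2 * ((velocity F w 1 k : ℂ) - Complex.I * velocity F w Complex.I k) := by
    ext w
    rw [zCoeff]
    ring
  rw [wirtingerBar, hZ, (((hd 1).fun_sub ((hd Complex.I).const_mul Complex.I)).const_mul _).fderiv]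
  simp only [_root_.smul_apply, _root_.sub_apply, ContinuousLinearMap.comp_apply,
    Complex.ofRealCLM_apply, smul_eq_mul, fderiv_apply (h.differentiableAt_velocity _),
    ContinuousLinearMap.proj_apply, Pi.add_apply, Pi.sub_apply]
  push_cast
  linear_combination
    -(fderiv ℝ (fun w => velocity F w Complex.I) z Complex.I k / 4 : ℂ) * Complex.I_sq

lemma IsConformalOn.wirtingerBar_zCoeff (h : IsConformalOn F D) (hz : z ∈ D) (k : Fin 3) :
    wirtingerBar (fun w => zCoeff F w k) z =
      ((((2 * meanCurvature F z) • (velocity F z 1 ⨯₃ velocity F z Complex.I) -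
          (leviCivita (velocity F z 1) (velocity F z 1) +
            leviCivita (velocity F z Complex.I) (velocity F z Complex.I))) k : ℝ) +
        Complex.I * (lieBracket (velocity F z 1) (velocity F z Complex.I) k : ℝ)) / 4 := by
  have hs := h.smoothAt z hz
  have hlaplace : fderiv ℝ (fun w => velocity F w 1) z 1 +
        fderiv ℝ (fun w => velocity F w Complex.I) z Complex.I =
      tension F z - (leviCivita (velocity F z 1) (velocity F z 1) +
        leviCivita (velocity F z Complex.I) (velocity F z Complex.I)) := by
    rw [tension, covDeriv_eq (hs.differentiableAt_velocity 1),
      covDeriv_eq (hs.differentiableAt_velocity Complex.I)]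
    abel
  have hcurl : fderiv ℝ (fun w => velocity F w 1) z Complex.I -
        fderiv ℝ (fun w => velocity F w Complex.I) z 1 =
      lieBracket (velocity F z 1) (velocity F z Complex.I) := by
    rw [← neg_sub, hs.fderiv_velocity_sub, neg_neg]
  rw [hs.wirtingerBar_zCoeff, hlaplace, hcurl, h.tension_eq hz]

/-- The square of the component `ψ₁` of a generating spinor `ψ` of `F`. -/
noncomputable def spinorSqFst (F : ℂ → SLTilde) (z : ℂ) : ℂ :=
  -Complex.I * zCoeff F z 0 + -1 * zCoeff F z 1

/-- The square of the conjugate of the component `ψ₂` of a generating spinor `ψ` of `F`. -/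
noncomputable def spinorSqSnd (F : ℂ → SLTilde) (z : ℂ) : ℂ :=
  -Complex.I * zCoeff F z 0 + 1 * zCoeff F z 1

lemma isSpinor_iff {ψ : ℂ × ℂ} : IsSpinor (zCoeff F z) ψ ↔
    ψ.1 ^ 2 = spinorSqFst F z ∧ (starRingEnd ℂ) ψ.2 ^ 2 = spinorSqSnd F z ∧
      ψ.1 * (starRingEnd ℂ) ψ.2 = zCoeff F z 2 := by
  have hI := Complex.I_sq
  rw [IsSpinor, spinorSqFst, spinorSqSnd]
  constructor <;> rintro ⟨h0, h1, h2⟩ <;> refine ⟨?_, ?_, h2.symm⟩ <;> grind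

lemma norm_spinorSqFst {ψ : ℂ × ℂ} (hψ : IsSpinor (zCoeff F z) ψ) :
    ‖spinorSqFst F z‖ = ‖ψ.1‖ ^ 2 := by
  rw [← (isSpinor_iff.1 hψ).1, norm_pow]

lemma norm_spinorSqSnd {ψ : ℂ × ℂ} (hψ : IsSpinor (zCoeff F z) ψ) :
    ‖spinorSqSnd F z‖ = ‖ψ.2‖ ^ 2 := by
  rw [← (isSpinor_iff.1 hψ).2.1, norm_pow, RCLike.norm_conj]

lemma SmoothAt.contDiffAt_spinorSqFst (h : SmoothAt F z) : ContDiffAt ℝ ∞ (spinorSqFst F) z :=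
  (contDiffAt_const.mul (h.contDiffAt_zCoeff 0)).add (contDiffAt_const.mul (h.contDiffAt_zCoeff 1))

lemma SmoothAt.contDiffAt_spinorSqSnd (h : SmoothAt F z) : ContDiffAt ℝ ∞ (spinorSqSnd F) z :=
  (contDiffAt_const.mul (h.contDiffAt_zCoeff 0)).add (contDiffAt_const.mul (h.contDiffAt_zCoeff 1))

lemma IsConformalOn.spinorSqFst_mul_spinorSqSnd (h : IsConformalOn F D) (hz : z ∈ D) :
    spinorSqFst F z * spinorSqSnd F z = zCoeff F z 2 ^ 2 := by
  have hsq := h.sq_eq z hz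
  have horth := h.orthogonal z hz
  simp only [Matrix.vec3_dotProduct, velocity_one_eq_re, velocity_I_eq_im] at hsq horth
  apply Complex.ext <;>
    simp only [spinorSqFst, spinorSqSnd, Complex.add_re, Complex.add_im, Complex.mul_re,
      Complex.mul_im, Complex.neg_re, Complex.neg_im, Complex.I_re, Complex.I_im, Complex.one_re,
      Complex.one_im, sq]
  · linear_combination -hsq / 4
  · linear_combination horth / 2

lemma IsConformalOn.spinorSqFst_ne_zero_or (h : IsConformalOn F D) (hz : z ∈ D) :
    spinorSqFst F z ≠ 0 ∨ spinorSqSnd F z ≠ 0 := by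
  by_contra! hzero
  have hsq : zCoeff F z 2 ^ 2 = 0 := by
    rw [← h.spinorSqFst_mul_spinorSqSnd hz, hzero.1, zero_mul]
  rw [spinorSqFst, spinorSqSnd] at hzero
  have hZ0 : zCoeff F z 0 = 0 := (mul_eq_zero.1 (by linear_combination (hzero.1 + hzero.2) / 2 :
    -Complex.I * zCoeff F z 0 = 0)).resolve_left (neg_ne_zero.2 Complex.I_ne_zero)
  have hZ1 : zCoeff F z 1 = 0 := by linear_combination (hzero.2 - hzero.1) / 2
  have hZ2 : zCoeff F z 2 = 0 := pow_eq_zero_iff two_ne_zero |>.1 hsq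
  refine h.velocity_ne_zero z hz (funext fun k => ?_)
  fin_cases k <;> simp [velocity_one_eq_re, hZ0, hZ1, hZ2]

lemma exists_contDiffAt_sqrt {f : ℂ → ℂ} {n : WithTop ℕ∞} (hf : ContDiffAt ℝ n f z)
    (h0 : f z ≠ 0) :
    ∃ g : ℂ → ℂ, ContDiffAt ℝ n g z ∧ ∀ᶠ w in nhds z, g w ^ 2 = f w ∧ g w ≠ 0 := by
  obtain ⟨c, hc⟩ := IsAlgClosed.exists_pow_nat_eq (f z) two_pos
  have hc0 : c ≠ 0 := by
    rintro rfl
    exact h0 (by rw [← hc, zero_pow two_ne_zero])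
  have hslit : f z / f z ∈ Complex.slitPlane := by
    rw [div_self h0]
    exact Complex.one_mem_slitPlane
  have hlog : ContDiffAt ℝ n (fun w => Complex.log (f w / f z)) z :=
    ContDiffAt.comp (g := Complex.log) z ((Complex.contDiffAt_log hslit).restrict_scalars ℝ)
      (hf.div_const _)
  refine ⟨fun w => c * Complex.exp (Complex.log (f w / f z) / 2),
    contDiffAt_const.mul (hlog.div_const 2).cexp, ?_⟩
  filter_upwards [hf.continuousAt.eventually_ne h0] with w hw
  refine ⟨?_, mul_ne_zero hc0 (Complex.exp_ne_zero _)⟩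
  rw [mul_pow, ← Complex.exp_nat_mul, Nat.cast_ofNat, mul_div_cancel₀ _ two_ne_zero,
    Complex.exp_log (div_ne_zero hw h0), hc, mul_div_cancel₀ _ h0]

lemma IsConformalOn.isSpinor_of_sq_eq_fst (h : IsConformalOn F D) (hz : z ∈ D) {a : ℂ}
    (ha : a ^ 2 = spinorSqFst F z) (ha0 : a ≠ 0) :
    IsSpinor (zCoeff F z) (a, (starRingEnd ℂ) (zCoeff F z 2 / a)) := by
  have hmul := h.spinorSqFst_mul_spinorSqSnd hz
  rw [← ha] at hmul
  refine isSpinor_iff.2 ⟨ha, ?_, ?_⟩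
  · rw [Complex.conj_conj, div_pow, ← hmul, mul_div_cancel_left₀ _ (pow_ne_zero 2 ha0)]
  · rw [Complex.conj_conj, mul_div_cancel₀ _ ha0]

lemma IsConformalOn.isSpinor_of_sq_eq_snd (h : IsConformalOn F D) (hz : z ∈ D) {c : ℂ}
    (hc : c ^ 2 = spinorSqSnd F z) (hc0 : c ≠ 0) :
    IsSpinor (zCoeff F z) (zCoeff F z 2 / c, (starRingEnd ℂ) c) := by
  have hmul := h.spinorSqFst_mul_spinorSqSnd hz
  rw [← hc] at hmul
  refine isSpinor_iff.2 ⟨?_, ?_, ?_⟩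
  · rw [div_pow, ← hmul, mul_div_cancel_right₀ _ (pow_ne_zero 2 hc0)]
  · rw [Complex.conj_conj, hc]
  · rw [Complex.conj_conj, div_mul_cancel₀ _ hc0]

lemma IsConformalOn.exists_contDiffAt_spinor (h : IsConformalOn F D) (hz : z ∈ D) :
    ∃ ψ₁ ψ₂ : ℂ → ℂ, ContDiffAt ℝ 1 ψ₁ z ∧ ContDiffAt ℝ 1 ψ₂ z ∧
      ∀ᶠ w in nhds z, IsSpinor (zCoeff F w) (ψ₁ w, ψ₂ w) := by
  have hs := h.smoothAt z hz
  have hquot : ∀ g : ℂ → ℂ, ContDiffAt ℝ 1 g z → g z ≠ 0 →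
      ContDiffAt ℝ 1 (fun w => zCoeff F w 2 / g w) z := fun g hg hg0 => by
    simpa only [div_eq_mul_inv, Pi.inv_apply] using
      ((hs.contDiffAt_zCoeff 2).of_le (by simp)).mul (hg.inv hg0)
  have hconj : ContDiff ℝ 1 (starRingEnd ℂ) := Complex.conjCLE.contDiff
  rcases h.spinorSqFst_ne_zero_or hz with h0 | h0
  · obtain ⟨g, hg, hsq⟩ := exists_contDiffAt_sqrt
      (hs.contDiffAt_spinorSqFst.of_le (m := 1) (by simp)) h0
    refine ⟨g, _, hg, hconj.contDiffAt.comp z (hquot g hg hsq.self_of_nhds.2), ?_⟩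
    filter_upwards [hsq, h.isOpen.mem_nhds hz] with w hw hwD
    exact h.isSpinor_of_sq_eq_fst hwD hw.1 hw.2
  · obtain ⟨g, hg, hsq⟩ := exists_contDiffAt_sqrt
      (hs.contDiffAt_spinorSqSnd.of_le (m := 1) (by simp)) h0
    refine ⟨_, _, hquot g hg hsq.self_of_nhds.2, hconj.contDiffAt.comp z hg, ?_⟩
    filter_upwards [hsq, h.isOpen.mem_nhds hz] with w hw hwD
    exact h.isSpinor_of_sq_eq_snd hwD hw.1 hw.2

lemma IsConformalOn.exists_contDiffOn_spinor (h : IsConformalOn F D) (hz : z ∈ D) :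
    ∃ Ω : Set ℂ, IsOpen Ω ∧ z ∈ Ω ∧ Ω ⊆ D ∧ ∃ ψ₁ ψ₂ : ℂ → ℂ,
      ContDiffOn ℝ 1 ψ₁ Ω ∧ ContDiffOn ℝ 1 ψ₂ Ω ∧
      ∀ w ∈ Ω, IsSpinor (zCoeff F w) (ψ₁ w, ψ₂ w) := by
  obtain ⟨ψ₁, ψ₂, h₁, h₂, hψ⟩ := h.exists_contDiffAt_spinor hz
  obtain ⟨Ω, hΩ, hopen, hzΩ⟩ := eventually_nhds_iff.1
    ((h₁.eventually (by simp)).and ((h₂.eventually (by simp)).and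
      (hψ.and (h.isOpen.mem_nhds hz))))
  exact ⟨Ω, hopen, hzΩ, fun w hw => (hΩ w hw).2.2.2, ψ₁, ψ₂,
    fun w hw => (hΩ w hw).1.contDiffWithinAt, fun w hw => (hΩ w hw).2.1.contDiffWithinAt,
    fun w hw => (hΩ w hw).2.2.1⟩

lemma IsConformalOn.isSpinor_spinor (h : IsConformalOn F D) (hz : z ∈ D) :
    IsSpinor (zCoeff F z) (spinor F z) := by
  obtain ⟨ψ₁, ψ₂, -, -, hψ⟩ := h.exists_contDiffAt_spinor hz
  exact Classical.epsilon_spec ⟨_, hψ.self_of_nhds⟩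

/-! ### The Dirac equation -/

/-- The potential `U` of the Dirac operator, written with `‖spinorSqFst F z‖ = |ψ₁|²` and
`‖spinorSqSnd F z‖ = |ψ₂|²` so as not to depend on a choice of generating spinor. -/
noncomputable def potentialFst (F : ℂ → SLTilde) (z : ℂ) : ℂ :=
  meanCurvature F z / 2 * (‖spinorSqFst F z‖ + ‖spinorSqSnd F z‖) +
    Complex.I * (1 / 2 * ‖spinorSqFst F z‖ - 3 / 4 * ‖spinorSqSnd F z‖)

/-- The potential `V` of the Dirac operator, written like `potentialFst`. -/
noncomputable def potentialSnd (F : ℂ → SLTilde) (z : ℂ) : ℂ :=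
  meanCurvature F z / 2 * (‖spinorSqFst F z‖ + ‖spinorSqSnd F z‖) +
    Complex.I * (3 / 4 * ‖spinorSqFst F z‖ - 1 / 2 * ‖spinorSqSnd F z‖)

lemma IsConformalOn.continuousOn_norm_spinorSq (h : IsConformalOn F D) :
    ContinuousOn (fun w => (‖spinorSqFst F w‖ : ℂ)) D ∧
      ContinuousOn (fun w => (‖spinorSqSnd F w‖ : ℂ)) D :=
  ⟨fun z hz => (Complex.continuous_ofReal.continuousAt.comp
      (h.smoothAt z hz).contDiffAt_spinorSqFst.continuousAt.norm).continuousWithinAt,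
    fun z hz => (Complex.continuous_ofReal.continuousAt.comp
      (h.smoothAt z hz).contDiffAt_spinorSqSnd.continuousAt.norm).continuousWithinAt⟩

lemma IsConformalOn.continuousOn_potentialFst (h : IsConformalOn F D) :
    ContinuousOn (potentialFst F) D := by
  have hH := Complex.continuous_ofReal.comp_continuousOn h.continuousOn_meanCurvature
  obtain ⟨hfst, hsnd⟩ := h.continuousOn_norm_spinorSq
  exact ((hH.div_const 2).mul (hfst.add hsnd)).add (continuousOn_const.mul
    ((continuousOn_const.mul hfst).sub (continuousOn_const.mul hsnd)))

lemma IsConformalOn.continuousOn_potentialSnd (h : IsConformalOn F D) :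
    ContinuousOn (potentialSnd F) D := by
  have hH := Complex.continuous_ofReal.comp_continuousOn h.continuousOn_meanCurvature
  obtain ⟨hfst, hsnd⟩ := h.continuousOn_norm_spinorSq
  exact ((hH.div_const 2).mul (hfst.add hsnd)).add (continuousOn_const.mul
    ((continuousOn_const.mul hfst).sub (continuousOn_const.mul hsnd)))

lemma velocity_one_eq_of_isSpinor {ψ : ℂ × ℂ} (hψ : IsSpinor (zCoeff F z) ψ) :
    velocity F z 1 = ![2 * (ψ.2.re * ψ.2.im - ψ.1.re * ψ.1.im),
      ψ.2.re ^ 2 - ψ.2.im ^ 2 - ψ.1.re ^ 2 + ψ.1.im ^ 2,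
      2 * (ψ.1.re * ψ.2.re + ψ.1.im * ψ.2.im)] := by
  ext k
  rw [velocity_one_eq_re]
  fin_cases k <;> simp [hψ.1, hψ.2.1, hψ.2.2, sq] <;> ring

lemma velocity_I_eq_of_isSpinor {ψ : ℂ × ℂ} (hψ : IsSpinor (zCoeff F z) ψ) :
    velocity F z Complex.I = ![-(ψ.2.re ^ 2 - ψ.2.im ^ 2 + ψ.1.re ^ 2 - ψ.1.im ^ 2),
      2 * (ψ.2.re * ψ.2.im + ψ.1.re * ψ.1.im),
      2 * (ψ.1.re * ψ.2.im - ψ.1.im * ψ.2.re)] := by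
  ext k
  rw [velocity_I_eq_im]
  fin_cases k <;> simp [hψ.1, hψ.2.1, hψ.2.2, sq] <;> ring

lemma IsConformalOn.wirtingerBar_spinorSqFst (h : IsConformalOn F D) (hz : z ∈ D) {ψ : ℂ × ℂ}
    (hψ : IsSpinor (zCoeff F z) ψ) :
    wirtingerBar (spinorSqFst F) z = 2 * (ψ.1 * ψ.2) * potentialSnd F z := by
  have hd := fun k => (h.smoothAt z hz).differentiableAt_zCoeff k
  have hsum : wirtingerBar (spinorSqFst F) z =
      -Complex.I * wirtingerBar (fun w => zCoeff F w 0) z +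
        -1 * wirtingerBar (fun w => zCoeff F w 1) z :=
    wirtingerBar_const_mul_add (hd 0) (hd 1) _ _
  rw [hsum, h.wirtingerBar_zCoeff hz, h.wirtingerBar_zCoeff hz, potentialSnd,
    norm_spinorSqFst hψ, norm_spinorSqSnd hψ, velocity_one_eq_of_isSpinor hψ,
    velocity_I_eq_of_isSpinor hψ]
  apply Complex.ext <;>
    simp [leviCivita_eq, lieBracket, cross_apply, Complex.sq_norm, Complex.normSq_apply,
      -Complex.ofReal_pow] <;> ring

lemma IsConformalOn.wirtingerBar_spinorSqSnd (h : IsConformalOn F D) (hz : z ∈ D) {ψ : ℂ × ℂ}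
    (hψ : IsSpinor (zCoeff F z) ψ) :
    wirtingerBar (spinorSqSnd F) z =
      -2 * (starRingEnd ℂ) (ψ.1 * ψ.2 * potentialFst F z) := by
  have hd := fun k => (h.smoothAt z hz).differentiableAt_zCoeff k
  have hsum : wirtingerBar (spinorSqSnd F) z =
      -Complex.I * wirtingerBar (fun w => zCoeff F w 0) z +
        1 * wirtingerBar (fun w => zCoeff F w 1) z :=
    wirtingerBar_const_mul_add (hd 0) (hd 1) _ _
  rw [hsum, h.wirtingerBar_zCoeff hz, h.wirtingerBar_zCoeff hz, potentialFst,
    norm_spinorSqFst hψ, norm_spinorSqSnd hψ, velocity_one_eq_of_isSpinor hψ,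
    velocity_I_eq_of_isSpinor hψ]
  apply Complex.ext <;>
    simp [leviCivita_eq, lieBracket, cross_apply, Complex.sq_norm, Complex.normSq_apply,
      -Complex.ofReal_pow, Complex.conj_ofNat] <;> ring

lemma IsConformalOn.wirtingerBar_zCoeff_two (h : IsConformalOn F D) (hz : z ∈ D) :
    wirtingerBar (fun w => zCoeff F w 2) z = ‖spinorSqSnd F z‖ * potentialSnd F z -
      ‖spinorSqFst F z‖ * (starRingEnd ℂ) (potentialFst F z) := by
  have hψ := h.isSpinor_spinor hz
  rw [h.wirtingerBar_zCoeff hz, potentialFst, potentialSnd,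
    norm_spinorSqFst hψ, norm_spinorSqSnd hψ, velocity_one_eq_of_isSpinor hψ,
    velocity_I_eq_of_isSpinor hψ]
  apply Complex.ext <;>
    simp [leviCivita_eq, lieBracket, cross_apply, Complex.sq_norm, Complex.normSq_apply,
      -Complex.ofReal_pow, Complex.conj_ofNat] <;> ring

lemma eq_zero_and_eq_zero_of_mul_eq_mul {K : Type*} [MulZeroClass K] [NoZeroDivisors K]
    {a c x y : K} (hcx : c * x = 0) (hay : a * y = 0) (hxy : a * x = c * y) (hac : a ≠ 0 ∨ c ≠ 0) :
    x = 0 ∧ y = 0 := by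
  rcases hac with ha | hc
  · have hy := (mul_eq_zero.1 hay).resolve_left ha
    exact ⟨(mul_eq_zero.1 (by rw [hxy, hy, mul_zero])).resolve_left ha, hy⟩
  · have hx := (mul_eq_zero.1 hcx).resolve_left hc
    exact ⟨hx, (mul_eq_zero.1 (by rw [← hxy, hx, mul_zero])).resolve_left hc⟩

lemma IsConformalOn.dirac_of_isSpinor (h : IsConformalOn F D) (hz : z ∈ D) {ψ₁ ψ₂ : ℂ → ℂ}
    (hψ₁ : DifferentiableAt ℝ ψ₁ z) (hψ₂ : DifferentiableAt ℝ ψ₂ z)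
    (hψ : ∀ᶠ w in nhds z, IsSpinor (zCoeff F w) (ψ₁ w, ψ₂ w)) :
    wirtinger ψ₂ z + potentialFst F z * ψ₁ z = 0 ∧
      -wirtingerBar ψ₁ z + potentialSnd F z * ψ₂ z = 0 := by
  have hψz := hψ.self_of_nhds
  obtain ⟨hfst, hsnd, -⟩ := isSpinor_iff.1 hψz
  have hconj : DifferentiableAt ℝ (fun w => (starRingEnd ℂ) (ψ₂ w)) z :=
    Complex.conjCLE.differentiableAt.comp z hψ₂
  have hSqFst := wirtingerBar_congr (hψ.mono fun w hw => (isSpinor_iff.1 hw).1)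
  have hSqSnd := wirtingerBar_congr (hψ.mono fun w hw => (isSpinor_iff.1 hw).2.1)
  have hProd := wirtingerBar_congr (hψ.mono fun w hw => (isSpinor_iff.1 hw).2.2)
  simp only [sq, wirtingerBar_mul hψ₁ hψ₁, wirtingerBar_mul hconj hconj,
    wirtingerBar_mul hψ₁ hconj, wirtingerBar_conj] at hSqFst hSqSnd hProd
  rw [h.wirtingerBar_spinorSqFst hz hψz] at hSqFst
  rw [h.wirtingerBar_spinorSqSnd hz hψz, map_mul, map_mul] at hSqSnd
  rw [h.wirtingerBar_zCoeff_two hz, norm_spinorSqFst hψz, norm_spinorSqSnd hψz,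
    Complex.ofReal_pow, Complex.ofReal_pow, ← Complex.mul_conj', ← Complex.mul_conj'] at hProd
  rw [← map_eq_zero (starRingEnd ℂ), map_add, map_mul]
  refine eq_zero_and_eq_zero_of_mul_eq_mul (a := ψ₁ z) (c := (starRingEnd ℂ) (ψ₂ z)) ?_ ?_ ?_ ?_
  · linear_combination hSqSnd / 2
  · linear_combination -hSqFst / 2
  · linear_combination hProd
  · exact (h.spinorSqFst_ne_zero_or hz).imp (fun h0 h1 => h0 (by simp [← hfst, h1]))
      fun h0 h1 => h0 (by simp [← hsnd, h1])

lemma IsConformalOn.isDiracPotential (h : IsConformalOn F D) :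
    IsDiracPotential F D (potentialFst F) (potentialSnd F) := by
  refine ⟨h.continuousOn_potentialFst, h.continuousOn_potentialSnd, ?_⟩
  intro Ω hΩ hΩD ψ₁ ψ₂ h₁ h₂ hψ z hz
  have hnhds := hΩ.mem_nhds hz
  exact h.dirac_of_isSpinor (hΩD hz) ((h₁.contDiffAt hnhds).differentiableAt one_ne_zero)
    ((h₂.contDiffAt hnhds).differentiableAt one_ne_zero) (Filter.mem_of_superset hnhds hψ)

/-- If `Z₃` vanished near `z`, then `∂̄Z₃ = |ψ₂|² V - |ψ₁|² conj U` would vanish at `z`, which is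
impossible since exactly one of `ψ₁`, `ψ₂` is zero there. -/
lemma IsConformalOn.frequently_zCoeff_two_ne_zero (h : IsConformalOn F D) (hz : z ∈ D) :
    ∃ᶠ w in nhds z, zCoeff F w 2 ≠ 0 := by
  intro hnot
  have hzero : ∀ᶠ w in nhds z, zCoeff F w 2 = 0 := hnot.mono fun _ hw => not_not.1 hw
  have hbar := h.wirtingerBar_zCoeff_two hz
  rw [wirtingerBar_congr hzero, wirtingerBar, fderiv_fun_const] at hbar
  have him := congrArg Complex.im hbar
  have hmul : spinorSqFst F z * spinorSqSnd F z = 0 := by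
    rw [h.spinorSqFst_mul_spinorSqSnd hz, hzero.self_of_nhds, zero_pow two_ne_zero]
  rcases mul_eq_zero.1 hmul with h0 | h0
  · have hsnd := (h.spinorSqFst_ne_zero_or hz).resolve_left (not_not.2 h0)
    simp [potentialFst, potentialSnd, h0, hsnd] at him
  · have hfst := (h.spinorSqFst_ne_zero_or hz).resolve_right (not_not.2 h0)
    simp [potentialFst, potentialSnd, h0, hfst, Complex.conj_ofNat] at him

lemma IsConformalOn.eqOn_of_isDiracPotential_of_zCoeff_two_ne_zero (h : IsConformalOn F D)
    {U V U' V' : ℂ → ℂ} (hUV : IsDiracPotential F D U V) (hUV' : IsDiracPotential F D U' V')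
    (hz : z ∈ D) (hz0 : zCoeff F z 2 ≠ 0) : U z = U' z ∧ V z = V' z := by
  obtain ⟨Ω, hΩ, hzΩ, hΩD, ψ₁, ψ₂, h₁, h₂, hψ⟩ := h.exists_contDiffOn_spinor hz
  have hmul := (isSpinor_iff.1 (hψ z hzΩ)).2.2
  have hψ₁ : ψ₁ z ≠ 0 := left_ne_zero_of_mul (hmul ▸ hz0)
  have hψ₂ : ψ₂ z ≠ 0 := (map_ne_zero _).1 (right_ne_zero_of_mul (hmul ▸ hz0))
  obtain ⟨hU, hV⟩ := hUV.2.2 Ω hΩ hΩD ψ₁ ψ₂ h₁ h₂ hψ z hzΩ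
  obtain ⟨hU', hV'⟩ := hUV'.2.2 Ω hΩ hΩD ψ₁ ψ₂ h₁ h₂ hψ z hzΩ
  exact ⟨mul_right_cancel₀ hψ₁ (add_left_cancel (hU.trans hU'.symm)),
    mul_right_cancel₀ hψ₂ (add_left_cancel (hV.trans hV'.symm))⟩

theorem IsConformalOn.eqOn_of_isDiracPotential (h : IsConformalOn F D) {U V U' V' : ℂ → ℂ}
    (hUV : IsDiracPotential F D U V) (hUV' : IsDiracPotential F D U' V') :
    Set.EqOn U U' D ∧ Set.EqOn V V' D := by
  have hdense : D ⊆ closure {w ∈ D | zCoeff F w 2 ≠ 0} := fun w hw =>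
    mem_closure_iff_frequently.2 (((h.frequently_zCoeff_two_ne_zero hw).and_eventually
      (h.isOpen.mem_nhds hw)).mono fun _ hx => hx.symm)
  have heq := fun w (hw : w ∈ {w ∈ D | zCoeff F w 2 ≠ 0}) =>
    h.eqOn_of_isDiracPotential_of_zCoeff_two_ne_zero hUV hUV' hw.1 hw.2
  exact ⟨Set.EqOn.of_subset_closure (fun w hw => (heq w hw).1) hUV.1 hUV'.1 (Set.sep_subset _ _)
      hdense,
    Set.EqOn.of_subset_closure (fun w hw => (heq w hw).2) hUV.2.1 hUV'.2.1 (Set.sep_subset _ _)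
      hdense⟩

/-- The density of the energy: the real part of `U V`. -/
noncomputable def energyDensity (F : ℂ → SLTilde) (z : ℂ) : ℝ :=
  meanCurvature F z ^ 2 / 4 * (‖spinorSqFst F z‖ + ‖spinorSqSnd F z‖) ^ 2 -
    (1 / 2 * ‖spinorSqFst F z‖ - 3 / 4 * ‖spinorSqSnd F z‖) *
      (3 / 4 * ‖spinorSqFst F z‖ - 1 / 2 * ‖spinorSqSnd F z‖)

lemma IsConformalOn.energyDensity_eq (h : IsConformalOn F D) (hz : z ∈ D) :
    energyDensity F z =
      meanCurvature F z ^ 2 / 4 * (‖(spinor F z).1‖ ^ 2 + ‖(spinor F z).2‖ ^ 2) ^ 2 -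
        (1 / 2 * ‖(spinor F z).1‖ ^ 2 - 3 / 4 * ‖(spinor F z).2‖ ^ 2) *
          (3 / 4 * ‖(spinor F z).1‖ ^ 2 - 1 / 2 * ‖(spinor F z).2‖ ^ 2) := by
  have hψ := h.isSpinor_spinor hz
  rw [energyDensity, norm_spinorSqFst hψ, norm_spinorSqSnd hψ]

lemma IsConformalOn.potentialFst_mul_potentialSnd (h : IsConformalOn F D) (hz : z ∈ D) :
    potentialFst F z * potentialSnd F z = energyDensity F z -
      5 / 4 * Complex.I * (wirtingerBar (fun w => zCoeff F w 2) z).re := by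
  rw [h.wirtingerBar_zCoeff_two hz]
  apply Complex.ext <;>
    simp [potentialFst, potentialSnd, energyDensity, sq, Complex.conj_ofNat] <;> ring

lemma IsConformalOn.continuousOn_energyDensity (h : IsConformalOn F D) :
    ContinuousOn (energyDensity F) D := by
  have hre : energyDensity F = fun w => (potentialFst F w * potentialSnd F w).re := by
    ext w
    simp [energyDensity, potentialFst, potentialSnd]
    ring
  rw [hre]
  exact Complex.continuous_re.comp_continuousOn
    (h.continuousOn_potentialFst.mul h.continuousOn_potentialSnd)

/-! ### Conformal immersions of surfaces in their charts -/

lemma SmoothAt.trace_maurerCartanForm (h : SmoothAt F z) (u : ℂ) :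
    (maurerCartanForm F z u).trace = 0 := by
  have hE := fun i j => (h.differentiableAt i j).hasFDerivAt
  have hdet : (fun w => (proj (F w)).1 0 0 * (proj (F w)).1 1 1 -
      (proj (F w)).1 0 1 * (proj (F w)).1 1 0) = fun _ => (1 : ℝ) :=
    funext fun w => (Matrix.det_fin_two _).symm.trans (proj (F w)).2
  have hd := ((hE 0 0).fun_mul (hE 1 1)).fun_sub ((hE 0 1).fun_mul (hE 1 0))
  rw [hdet] at hd
  have hu := congrArg (· u) (hd.unique (hasFDerivAt_const (1 : ℝ) z))
  simp only [_root_.sub_apply, _root_.add_apply, _root_.smul_apply, zero_apply, smul_eq_mul] at hu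
  simp only [maurerCartanForm, Matrix.SpecialLinearGroup.coe_inv, Matrix.adjugate_fin_two,
    Matrix.trace_fin_two, Matrix.mul_apply, Fin.sum_univ_two, matrixDeriv_apply, Matrix.of_apply,
    Matrix.cons_val', Matrix.cons_val_zero, Matrix.cons_val_one, Matrix.cons_val_fin_one]
  linear_combination hu

lemma SmoothAt.matrixDeriv_eq_zero (h : SmoothAt F z) {u : ℂ} (hu : velocity F z u = 0) :
    matrixDeriv (fun w => (proj (F w)).1) z u = 0 := by
  have hform : maurerCartanForm F z u = 0 := by
    rw [← sum_coord_smul_basis _ (h.trace_maurerCartanForm u), ← velocity_eq_coord, hu]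
    simp
  have hinv : (proj (F z)).1 * ((proj (F z))⁻¹).1 = 1 :=
    congrArg Subtype.val (mul_inv_cancel (proj (F z)))
  rw [← Matrix.one_mul (matrixDeriv _ _ _), ← hinv, Matrix.mul_assoc]
  change _ * maurerCartanForm F z u = 0
  rw [hform, Matrix.mul_zero]

lemma contDiff_proj (i j : Fin 2) : ContDiff ℝ ω (fun g : ℝ × ℂ => (proj g).1 i j) := by
  have har := Complex.reCLM.contDiff.comp contDiff_a
  have hai := Complex.imCLM.contDiff.comp contDiff_a
  have hbr := Complex.reCLM.contDiff.comp contDiff_b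
  have hbi := Complex.imCLM.contDiff.comp contDiff_b
  fin_cases i <;> fin_cases j
  exacts [har.add hbr, hbi.sub hai, hai.add hbi, har.sub hbr]

lemma fderiv_a_apply (g : ℝ × ℂ) (t : ℝ) :
    fderiv ℝ (fun g : ℝ × ℂ => a g) g (t, 0) = a g * (t * Complex.I) := by
  have hline : HasDerivAt (fun s : ℝ => g + s • ((t, 0) : ℝ × ℂ)) (t, 0) 0 := by
    simpa using ((hasDerivAt_id (0 : ℝ)).smul_const ((t, 0) : ℝ × ℂ)).const_add g
  have hcomp := HasFDerivAt.comp_hasDerivAt (0 : ℝ) (l := fun g : ℝ × ℂ => a g)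
    (by simpa using (contDiff_a.differentiable (by simp) g).hasFDerivAt) hline
  have hexp : HasDerivAt (fun s : ℝ => a g * Complex.exp ((s : ℂ) * (t * Complex.I)))
      (a g * (t * Complex.I)) 0 := by
    simpa using ((Complex.ofRealCLM.hasDerivAt (x := (0 : ℝ))).mul_const
      ((t : ℂ) * Complex.I)).cexp.const_mul (a g)
  refine hcomp.unique (hexp.congr_of_eventuallyEq (.of_forall fun s => ?_))
  simp only [Function.comp_apply, a, theta, b, Prod.fst_add, Prod.snd_add, Prod.smul_fst,
    Prod.smul_snd, smul_eq_mul, smul_zero, add_zero]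
  rw [mul_assoc, ← Complex.exp_add]
  push_cast
  ring_nf

/-- The global coordinates `(θ, b)` of `SL̃₂`. -/
def coords (g : SLTilde) : ℝ × ℂ := (g.theta, g.b)

lemma SmoothAt.of_contDiffAt_coords (hF : ContDiffAt ℝ ∞ (fun w => coords (F w)) z) :
    SmoothAt F z := fun i j =>
  ((contDiff_proj i j).of_le le_top).contDiffAt.comp z hF

lemma hasFDerivAt_complex_mk {E : Type*} [NormedAddCommGroup E] [NormedSpace ℝ E] {x y : E → ℝ}
    {x' y' : E →L[ℝ] ℝ} {z : E} (hx : HasFDerivAt x x' z) (hy : HasFDerivAt y y' z) :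
    HasFDerivAt (fun w => (⟨x w, y w⟩ : ℂ))
      (Complex.equivRealProdCLM.symm.toContinuousLinearMap.comp (x'.prod y')) z :=
  Complex.equivRealProdCLM.symm.hasFDerivAt.comp z (hx.prodMk hy)

lemma SmoothAt.fderiv_a_eq_zero (h : SmoothAt F z) {u : ℂ} (hu : velocity F z u = 0) :
    fderiv ℝ (fun w => (F w).a) z u = 0 := by
  have hE := fun i j => (h.differentiableAt i j).hasFDerivAt
  have hzero : ∀ i j, fderiv ℝ (fun w => (proj (F w)).1 i j) z u = 0 := fun i j =>
    congrFun (congrFun (h.matrixDeriv_eq_zero hu) i) j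
  have hd := hasFDerivAt_complex_mk (((hE 0 0).fun_add (hE 1 1)).mul_const (2⁻¹ : ℝ))
    (((hE 1 0).fun_sub (hE 0 1)).mul_const (2⁻¹ : ℝ))
  simp only [← coeffA_proj, coeffA, div_eq_mul_inv]
  rw [hd.fderiv]
  simp [hzero]

lemma SmoothAt.fderiv_b_eq_zero (h : SmoothAt F z) {u : ℂ} (hu : velocity F z u = 0) :
    fderiv ℝ (fun w => (F w).b) z u = 0 := by
  have hE := fun i j => (h.differentiableAt i j).hasFDerivAt
  have hzero : ∀ i j, fderiv ℝ (fun w => (proj (F w)).1 i j) z u = 0 := fun i j =>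
    congrFun (congrFun (h.matrixDeriv_eq_zero hu) i) j
  have hd := hasFDerivAt_complex_mk (((hE 0 0).fun_sub (hE 1 1)).mul_const (2⁻¹ : ℝ))
    (((hE 1 0).fun_add (hE 0 1)).mul_const (2⁻¹ : ℝ))
  simp only [← coeffB_proj, coeffB, div_eq_mul_inv]
  rw [hd.fderiv]
  simp [hzero]

theorem fderiv_coords_eq_zero (hF : ContDiffAt ℝ ∞ (fun w => coords (F w)) z) {u : ℂ}
    (hu : velocity F z u = 0) : fderiv ℝ (fun w => coords (F w)) z u = 0 := by
  have h := SmoothAt.of_contDiffAt_coords hF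
  have hF' := (hF.differentiableAt (by simp)).hasFDerivAt
  have hb : (fderiv ℝ (fun w => coords (F w)) z u).2 = 0 := by
    have hcomp : fderiv ℝ (fun w => (F w).b) z u = (fderiv ℝ (fun w => coords (F w)) z u).2 :=
      congrArg (· u) ((ContinuousLinearMap.snd ℝ ℝ ℂ).hasFDerivAt.comp z hF').fderiv
    rw [← hcomp, h.fderiv_b_eq_zero hu]
  have ha : (F z).a * ((fderiv ℝ (fun w => coords (F w)) z u).1 * Complex.I) = 0 := by
    have hcomp := congrArg (· u) (HasFDerivAt.comp (g := fun g : ℝ × ℂ => a g) z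
      (contDiff_a.differentiable (by simp) (coords (F z))).hasFDerivAt hF').fderiv
    refine ((fderiv_a_apply (coords (F z)) _).symm.trans ?_).trans (h.fderiv_a_eq_zero hu)
    rw [← hb]
    exact hcomp.symm
  refine Prod.ext ?_ hb
  simpa [a_ne_zero] using ha

end SLTilde

open SLTilde MeasureTheory

/-! ### Integration in the plane -/

section Planar

variable {D K : Set ℂ}

lemma integrableOn_of_zero_off_compact {E : Type*} [NormedAddCommGroup E] {h : ℂ → E}
    (hD : IsOpen D) (hK : IsCompact K) (hKD : K ⊆ D) (hh : ContinuousOn h D)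
    (hzero : ∀ z ∈ D \ K, h z = 0) : IntegrableOn h D :=
  ((hh.mono hKD).integrableOn_compact hK).of_forall_sdiff_eq_zero hD.measurableSet hzero

lemma contDiff_indicator_of_zero_off_closed {𝕜 E G : Type*} [NontriviallyNormedField 𝕜]
    [NormedAddCommGroup E] [NormedSpace 𝕜 E] [NormedAddCommGroup G] [NormedSpace 𝕜 G]
    {D K : Set E} {h : E → G} {n : WithTop ℕ∞} (hD : IsOpen D) (hK : IsClosed K) (hKD : K ⊆ D)
    (hh : ContDiffOn 𝕜 n h D) (hzero : ∀ z ∈ D \ K, h z = 0) : ContDiff 𝕜 n (D.indicator h) := by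
  refine contDiff_iff_contDiffAt.2 fun z => ?_
  by_cases hz : z ∈ D
  · exact (hh.contDiffAt (hD.mem_nhds hz)).congr_of_eventuallyEq
      (Set.eqOn_indicator.eventuallyEq_of_mem (hD.mem_nhds hz))
  · refine contDiffAt_const (c := (0 : G)) |>.congr_of_eventuallyEq ?_
    filter_upwards [hK.isOpen_compl.mem_nhds fun hzK => hz (hKD hzK)] with w hw
    exact Set.indicator_apply_eq_zero.2 fun hwD => hzero w ⟨hwD, hw⟩

lemma integral_fderiv_eq_zero_of_hasCompactSupport {E G : Type*} [NormedAddCommGroup E]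
    [NormedSpace ℝ E] [FiniteDimensional ℝ E] [MeasurableSpace E] [BorelSpace E]
    [NormedAddCommGroup G] [NormedSpace ℝ G] {μ : Measure E} [μ.IsAddHaarMeasure] {h : E → G}
    (hh : ContDiff ℝ 1 h) (hsupp : HasCompactSupport h) (v : E) :
    ∫ z, fderiv ℝ h z v ∂μ = 0 := by
  have hint := hh.continuous.integrable_of_hasCompactSupport hsupp (μ := μ)
  have hint' := ((hh.continuous_fderiv one_ne_zero).clm_apply
    (continuous_const (y := v))).integrable_of_hasCompactSupport (hsupp.fderiv_apply ℝ v) (μ := μ)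
  simpa using integral_smul_fderiv_eq_neg_fderiv_smul_of_integrable (μ := μ)
    (f := fun _ : E => (1 : ℝ)) (g := h) (v := v) (by simp) (by simpa using hint')
    (by simpa using hint) (fun _ _ => differentiableAt_const _)
    (fun z _ => hh.differentiable one_ne_zero z)

lemma setIntegral_wirtingerBar_eq_zero {h : ℂ → ℂ} (hD : IsOpen D) (hK : IsCompact K)
    (hKD : K ⊆ D) (hh : ContDiffOn ℝ 1 h D) (hzero : ∀ z ∈ D \ K, h z = 0) :
    ∫ z in D, wirtingerBar h z = 0 := by
  have hsmooth := contDiff_indicator_of_zero_off_closed hD hK.isClosed hKD hh hzero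
  have hsupp : HasCompactSupport (D.indicator h) := HasCompactSupport.intro hK fun z hz =>
    Set.indicator_apply_eq_zero.2 fun hzD => hzero z ⟨hzD, hz⟩
  have hint : ∀ u, Integrable fun z => fderiv ℝ (D.indicator h) z u := fun u =>
    ((hsmooth.continuous_fderiv one_ne_zero).clm_apply continuous_const
      ).integrable_of_hasCompactSupport (hsupp.fderiv_apply ℝ u)
  have hbar : ∫ z, wirtingerBar (D.indicator h) z = 0 := by
    simp only [wirtingerBar]
    rw [integral_div, integral_add (hint 1) ((hint Complex.I).const_mul _), integral_const_mul,
      integral_fderiv_eq_zero_of_hasCompactSupport hsmooth hsupp,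
      integral_fderiv_eq_zero_of_hasCompactSupport hsmooth hsupp, mul_zero, add_zero, zero_div]
  have hoff : ∀ z ∉ D, wirtingerBar (D.indicator h) z = 0 := fun z hz => by
    have hnear : D.indicator h =ᶠ[nhds z] fun _ => 0 := by
      filter_upwards [hK.isClosed.isOpen_compl.mem_nhds fun hzK => hz (hKD hzK)] with w hw
      exact Set.indicator_apply_eq_zero.2 fun hwD => hzero w ⟨hwD, hw⟩
    rw [wirtingerBar_congr hnear]
    simp [wirtingerBar]
  rw [← hbar, ← setIntegral_eq_integral_of_forall_compl_eq_zero hoff]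
  exact setIntegral_congr_fun hD.measurableSet fun z hz =>
    (wirtingerBar_congr (Set.eqOn_indicator.eventuallyEq_of_mem (hD.mem_nhds hz))).symm

lemma det_smul_one_eq_normSq (c : ℂ) : (c • (1 : ℂ →L[ℝ] ℂ)).det = Complex.normSq c := by
  rw [← Algebra.norm_complex_apply, Algebra.norm_apply]
  rfl

lemma setIntegral_source_eq_setIntegral_target {E : Type*} [NormedAddCommGroup E]
    [NormedSpace ℝ E] {φ : OpenPartialHomeomorph ℂ ℂ} (hφ : DifferentiableOn ℂ φ φ.source)
    {h h' : ℂ → E} (hh : ∀ z ∈ φ.source, h z = Complex.normSq (deriv φ z) • h' (φ z)) :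
    ∫ z in φ.source, h z = ∫ z in φ.target, h' z := by
  have hderiv : ∀ z ∈ φ.source, HasDerivAt φ (deriv φ z) z := fun z hz =>
    (hφ.differentiableAt (φ.open_source.mem_nhds hz)).hasDerivAt
  rw [← φ.image_source_eq_target, integral_image_eq_integral_abs_det_fderiv_smul volume
    φ.open_source.measurableSet
    (fun z hz => (hderiv z hz).complexToReal_fderiv.hasFDerivWithinAt) φ.injOn]
  refine setIntegral_congr_fun φ.open_source.measurableSet fun z hz => ?_
  simp only [hh z hz, det_smul_one_eq_normSq, abs_of_nonneg (Complex.normSq_nonneg _)]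

end Planar

/-! ### Charts of a Riemann surface -/

section Charts

variable {M : Type*} [TopologicalSpace M] {e e' : OpenPartialHomeomorph M ℂ}

lemma eventually_symm_transition_eq {z : ℂ} (hz : z ∈ (e.symm.trans e').source) :
    ∀ᶠ w in nhds z, e'.symm ((e.symm.trans e') w) = e.symm w := by
  filter_upwards [(e.symm.trans e').open_source.mem_nhds hz] with w hw
  rw [OpenPartialHomeomorph.trans_source] at hw
  exact e'.left_inv hw.2

lemma transition_mem_target {z : ℂ} (hz : z ∈ (e.symm.trans e').source) :
    (e.symm.trans e') z ∈ e'.target := by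
  rw [OpenPartialHomeomorph.trans_source] at hz
  exact e'.map_source hz.2

section CompactSubset

variable {K : Set M}

lemma isCompact_chart_image (hK : IsCompact K) (hKe : K ⊆ e.source) : IsCompact (e '' K) :=
  hK.image_of_continuousOn (e.continuousOn.mono hKe)

lemma chart_image_subset_target (hKe : K ⊆ e.source) : e '' K ⊆ e.target :=
  (Set.image_mono hKe).trans e.image_source_eq_target.subset

lemma symm_notMem_of_mem_target_sdiff_image {z : ℂ} (hz : z ∈ e.target \ e '' K) :
    e.symm z ∉ K := fun h => hz.2 ⟨_, h, e.right_inv hz.1⟩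

lemma integrableOn_target_of_zero_off_compact {E : Type*} [NormedAddCommGroup E] {h : ℂ → E}
    (hK : IsCompact K) (hKe : K ⊆ e.source) (hh : ContinuousOn h e.target)
    (hzero : ∀ z ∈ e.target, e.symm z ∉ K → h z = 0) : IntegrableOn h e.target :=
  integrableOn_of_zero_off_compact e.open_target (isCompact_chart_image hK hKe)
    (chart_image_subset_target hKe) hh
    fun z hz => hzero z hz.1 (symm_notMem_of_mem_target_sdiff_image hz)

lemma setIntegral_target_wirtingerBar_eq_zero {h : ℂ → ℂ} (hK : IsCompact K)
    (hKe : K ⊆ e.source) (hh : ContDiffOn ℝ 1 h e.target)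
    (hzero : ∀ z ∈ e.target, e.symm z ∉ K → h z = 0) :
    ∫ z in e.target, wirtingerBar h z = 0 :=
  setIntegral_wirtingerBar_eq_zero e.open_target (isCompact_chart_image hK hKe)
    (chart_image_subset_target hKe) hh
    fun z hz => hzero z hz.1 (symm_notMem_of_mem_target_sdiff_image hz)

end CompactSubset

lemma wirtingerBar_comp_symm_eq_zero {ρ : M → ℂ} {z : ℂ} (hz : z ∈ e.target)
    (h : e.symm z ∉ tsupport ρ) : wirtingerBar (ρ ∘ e.symm) z = 0 := by
  have hnear : ρ ∘ e.symm =ᶠ[nhds z] fun _ => 0 := by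
    filter_upwards [(e.continuousAt_symm hz).eventually
      ((isClosed_tsupport ρ).isOpen_compl.mem_nhds h)] with w hw
    exact image_eq_zero_of_notMem_tsupport (f := ρ) hw
  rw [wirtingerBar_congr hnear]
  simp [wirtingerBar]

variable [ChartedSpace ℂ M] [IsManifold 𝓘(ℂ) ω M]

lemma contDiffOn_comp_chart_symm {E : Type*} [NormedAddCommGroup E] [NormedSpace ℝ E] {g : M → E}
    (hg : ContMDiff 𝓘(ℝ, ℂ) 𝓘(ℝ, E) ∞ g) (he : e ∈ atlas ℂ M) :
    ContDiffOn ℝ ∞ (g ∘ e.symm) e.target := by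
  have := isManifold_real_of_complex M
  exact contMDiffOn_iff_contDiffOn.1 (hg.comp_contMDiffOn
    (contMDiffOn_symm_of_mem_maximalAtlas (I := 𝓘(ℝ, ℂ)) (IsManifold.subset_maximalAtlas he)))

lemma differentiableOn_transition (he : e ∈ atlas ℂ M) (he' : e' ∈ atlas ℂ M) :
    DifferentiableOn ℂ (e.symm.trans e') (e.symm.trans e').source := by
  have h := (contDiffGroupoid ω 𝓘(ℂ)).compatible he he'
  rw [contDiffGroupoid, mem_groupoid_of_pregroupoid] at h
  have hω : ContDiffOn ℂ ω (e.symm.trans e') (e.symm.trans e').source := by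
    simpa [contDiffPregroupoid] using h.1
  exact hω.differentiableOn (by simp)

lemma hasDerivAt_transition (he : e ∈ atlas ℂ M) (he' : e' ∈ atlas ℂ M) {z : ℂ}
    (hz : z ∈ (e.symm.trans e').source) :
    HasDerivAt (e.symm.trans e') (deriv (e.symm.trans e') z) z :=
  ((differentiableOn_transition he he').differentiableAt
    ((e.symm.trans e').open_source.mem_nhds hz)).hasDerivAt

lemma setIntegral_target_eq_of_transition {E : Type*} [NormedAddCommGroup E] [NormedSpace ℝ E]
    {h h' : ℂ → E} (he : e ∈ atlas ℂ M) (he' : e' ∈ atlas ℂ M)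
    (hh : ∀ z ∈ (e.symm.trans e').source,
      h z = Complex.normSq (deriv (e.symm.trans e') z) • h' ((e.symm.trans e') z))
    (hzero : ∀ z ∈ e.target, e.symm z ∉ e'.source → h z = 0)
    (hzero' : ∀ z ∈ e'.target, e'.symm z ∉ e.source → h' z = 0) :
    ∫ z in e.target, h z = ∫ z in e'.target, h' z := by
  have hsource : (e.symm.trans e').source = e.target ∩ e.symm ⁻¹' e'.source := by
    rw [OpenPartialHomeomorph.trans_source]
    rfl
  have htarget : (e.symm.trans e').target = e'.target ∩ e'.symm ⁻¹' e.source := by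
    rw [OpenPartialHomeomorph.trans_target]
    rfl
  rw [setIntegral_eq_of_subset_of_forall_sdiff_eq_zero e.open_target.measurableSet
      (hsource.trans_subset Set.inter_subset_left)
      fun z hz => hzero z hz.1 fun hz' => hz.2 (hsource ▸ ⟨hz.1, hz'⟩),
    setIntegral_eq_of_subset_of_forall_sdiff_eq_zero e'.open_target.measurableSet
      (htarget.trans_subset Set.inter_subset_left)
      fun z hz => hzero' z hz.1 fun hz' => hz.2 (htarget ▸ ⟨hz.1, hz'⟩)]
  exact setIntegral_source_eq_setIntegral_target (differentiableOn_transition he he') hh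

end Charts

/-! ### Stokes' theorem for forms of type `(1, 0)` -/

section Stokes

variable {M : Type*} [TopologicalSpace M] {e e' : OpenPartialHomeomorph M ℂ}
  {ρ σ : M → ℂ} {ζ : OpenPartialHomeomorph M ℂ → ℂ → ℂ}

/-- The coefficient of the `2`-form `∂̄ρ ∧ ζ`, for a form `ζ` of type `(1, 0)`, with respect to
`dz̄ ∧ dz` in the chart `e`. -/
noncomputable def dbarWedge (ρ : M → ℂ) (ζ : OpenPartialHomeomorph M ℂ → ℂ → ℂ)
    (e : OpenPartialHomeomorph M ℂ) (z : ℂ) : ℂ :=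
  wirtingerBar (ρ ∘ e.symm) z * ζ e z

lemma dbarWedge_eq_zero {z : ℂ} (hz : z ∈ e.target) (h : e.symm z ∉ tsupport ρ) :
    dbarWedge ρ ζ e z = 0 := by
  rw [dbarWedge, wirtingerBar_comp_symm_eq_zero hz h, zero_mul]

variable [ChartedSpace ℂ M]

/-- The functions `ζ e` are the coefficients of a `C¹` form of type `(1, 0)`, equal to `ζ e z dz`
in the chart `e`. -/
structure IsOneZeroForm (ζ : OpenPartialHomeomorph M ℂ → ℂ → ℂ) : Prop where
  contDiffOn : ∀ e ∈ atlas ℂ M, ContDiffOn ℝ 1 (ζ e) e.target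
  eq_deriv_mul : ∀ e ∈ atlas ℂ M, ∀ e' ∈ atlas ℂ M, ∀ z ∈ (e.symm.trans e').source,
    ζ e z = deriv (e.symm.trans e') z * ζ e' ((e.symm.trans e') z)

variable [IsManifold 𝓘(ℂ) ω M]

lemma continuousOn_dbarWedge (hζ : IsOneZeroForm ζ) (hρ : ContMDiff 𝓘(ℝ, ℂ) 𝓘(ℝ, ℂ) ∞ ρ)
    (he : e ∈ atlas ℂ M) : ContinuousOn (dbarWedge ρ ζ e) e.target :=
  (continuousOn_wirtingerBar e.open_target
    ((contDiffOn_comp_chart_symm hρ he).of_le (by simp))).mul (hζ.contDiffOn e he).continuousOn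

lemma dbarWedge_eq_normSq_smul (hζ : IsOneZeroForm ζ) (hρ : ContMDiff 𝓘(ℝ, ℂ) 𝓘(ℝ, ℂ) ∞ ρ)
    (he : e ∈ atlas ℂ M) (he' : e' ∈ atlas ℂ M) {z : ℂ} (hz : z ∈ (e.symm.trans e').source) :
    dbarWedge ρ ζ e z =
      Complex.normSq (deriv (e.symm.trans e') z) • dbarWedge ρ ζ e' ((e.symm.trans e') z) := by
  have hdiff : DifferentiableAt ℝ (ρ ∘ e'.symm) ((e.symm.trans e') z) :=
    ((contDiffOn_comp_chart_symm hρ he').contDiffAt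
      (e'.open_target.mem_nhds (transition_mem_target hz))).differentiableAt (by simp)
  have hnear : ρ ∘ e.symm =ᶠ[nhds z] (ρ ∘ e'.symm) ∘ e.symm.trans e' :=
    (eventually_symm_transition_eq hz).mono fun w hw => congrArg ρ hw.symm
  rw [dbarWedge, dbarWedge, wirtingerBar_congr hnear,
    wirtingerBar_comp hdiff (hasDerivAt_transition he he' hz), hζ.eq_deriv_mul e he e' he' z hz,
    Complex.real_smul, Complex.normSq_eq_conj_mul_self]
  ring

lemma setIntegral_mul_dbarWedge_eq (hζ : IsOneZeroForm ζ)
    (hρ : ContMDiff 𝓘(ℝ, ℂ) 𝓘(ℝ, ℂ) ∞ ρ) (he : e ∈ atlas ℂ M) (he' : e' ∈ atlas ℂ M)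
    (hρe : tsupport ρ ⊆ e.source) (hσe' : tsupport σ ⊆ e'.source) :
    ∫ z in e.target, σ (e.symm z) * dbarWedge ρ ζ e z =
      ∫ z in e'.target, σ (e'.symm z) * dbarWedge ρ ζ e' z := by
  refine setIntegral_target_eq_of_transition he he' (fun z hz => ?_) (fun z _ hz' => ?_)
    fun z hz hz' => ?_
  · rw [dbarWedge_eq_normSq_smul hζ hρ he he' hz, (eventually_symm_transition_eq hz).self_of_nhds,
      mul_smul_comm]
  · rw [image_eq_zero_of_notMem_tsupport fun h => hz' (hσe' h), zero_mul]
  · rw [dbarWedge_eq_zero hz fun h => hz' (hρe h), mul_zero]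

lemma setIntegral_mul_wirtingerBar_eq_neg (hζ : IsOneZeroForm ζ)
    (hρ : ContMDiff 𝓘(ℝ, ℂ) 𝓘(ℝ, ℂ) ∞ ρ) (hcompact : HasCompactSupport ρ) (he : e ∈ atlas ℂ M)
    (hρe : tsupport ρ ⊆ e.source) :
    ∫ z in e.target, ρ (e.symm z) * wirtingerBar (ζ e) z =
      -∫ z in e.target, dbarWedge ρ ζ e z := by
  have hρC := (contDiffOn_comp_chart_symm hρ he).of_le (m := 1) (by simp)
  have hζC := hζ.contDiffOn e he
  have hoff : ∀ z ∈ e.target, e.symm z ∉ tsupport ρ → ρ (e.symm z) = 0 := fun _ _ =>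
    image_eq_zero_of_notMem_tsupport
  have hleibniz : ∀ z ∈ e.target, wirtingerBar (fun w => (ρ ∘ e.symm) w * ζ e w) z =
      ρ (e.symm z) * wirtingerBar (ζ e) z + dbarWedge ρ ζ e z := fun z hz =>
    wirtingerBar_mul ((hρC.contDiffAt (e.open_target.mem_nhds hz)).differentiableAt one_ne_zero)
      ((hζC.contDiffAt (e.open_target.mem_nhds hz)).differentiableAt one_ne_zero)
  have hstokes := setIntegral_target_wirtingerBar_eq_zero hcompact hρe (hρC.mul hζC)
    fun z hz h => by rw [Function.comp_apply, hoff z hz h, zero_mul]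
  have hintFst : IntegrableOn (fun z => ρ (e.symm z) * wirtingerBar (ζ e) z) e.target :=
    integrableOn_target_of_zero_off_compact hcompact hρe
      (hρC.continuousOn.mul (continuousOn_wirtingerBar e.open_target hζC))
      fun z hz h => by rw [hoff z hz h, zero_mul]
  have hintSnd := integrableOn_target_of_zero_off_compact hcompact hρe
    (continuousOn_dbarWedge hζ hρ he) fun z hz h => dbarWedge_eq_zero hz h
  rw [eq_neg_iff_add_eq_zero, ← integral_add hintFst hintSnd, ← hstokes]
  exact setIntegral_congr_fun e.open_target.measurableSet fun z hz => (hleibniz z hz).symm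

section Family

variable {ι : Type*} {s : Finset ι} {χ : ι → M → ℂ}

lemma sum_dbarWedge_eq_zero (hχ : ∀ i, ContMDiff 𝓘(ℝ, ℂ) 𝓘(ℝ, ℂ) ∞ (χ i))
    (hsum : ∀ x, ∑ i ∈ s, χ i x = 1) (he : e ∈ atlas ℂ M) {z : ℂ} (hz : z ∈ e.target) :
    ∑ i ∈ s, dbarWedge (χ i) ζ e z = 0 := by
  have hdiff : ∀ i, HasFDerivAt (χ i ∘ e.symm) (fderiv ℝ (χ i ∘ e.symm) z) z := fun i =>
    (((contDiffOn_comp_chart_symm (hχ i) he).contDiffAt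
      (e.open_target.mem_nhds hz)).differentiableAt (by simp)).hasFDerivAt
  have hderiv := HasFDerivAt.fun_sum (u := s) fun i _ => hdiff i
  simp only [Function.comp_apply, hsum] at hderiv
  have hzero : ∀ u, ∑ i ∈ s, fderiv ℝ (χ i ∘ e.symm) z u = 0 := fun u => by
    simpa using congrArg (fun l : ℂ →L[ℝ] ℂ => l u)
      (hderiv.unique (hasFDerivAt_const (1 : ℂ) z))
  simp only [dbarWedge, wirtingerBar, ← Finset.sum_mul, ← Finset.sum_div, Finset.sum_add_distrib,
    ← Finset.mul_sum, hzero, mul_zero, add_zero, zero_div, zero_mul]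

variable {c : ι → OpenPartialHomeomorph M ℂ}

lemma sum_setIntegral_mul_wirtingerBar_eq_zero (hζ : IsOneZeroForm ζ) (hc : ∀ i, c i ∈ atlas ℂ M)
    (hχ : ∀ i, ContMDiff 𝓘(ℝ, ℂ) 𝓘(ℝ, ℂ) ∞ (χ i)) (hcompact : ∀ i, HasCompactSupport (χ i))
    (hχc : ∀ i, tsupport (χ i) ⊆ (c i).source) (hsum : ∀ x, ∑ i ∈ s, χ i x = 1) :
    ∑ i ∈ s, ∫ z in (c i).target, χ i ((c i).symm z) * wirtingerBar (ζ (c i)) z = 0 := by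
  have hcont : ∀ i j k, ContinuousOn
      (fun z => χ j ((c k).symm z) * dbarWedge (χ i) ζ (c k) z) (c k).target := fun i j k =>
    (contDiffOn_comp_chart_symm (hχ j) (hc k)).continuousOn.mul
      (continuousOn_dbarWedge hζ (hχ i) (hc k))
  have hintFst : ∀ i j, IntegrableOn
      (fun z => χ j ((c i).symm z) * dbarWedge (χ i) ζ (c i) z) (c i).target := fun i j =>
    integrableOn_target_of_zero_off_compact (hcompact i) (hχc i) (hcont i j i)
      fun z hz h => by rw [dbarWedge_eq_zero hz h, mul_zero]
  have hintSnd : ∀ i j, IntegrableOn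
      (fun z => χ j ((c j).symm z) * dbarWedge (χ i) ζ (c j) z) (c j).target := fun i j =>
    integrableOn_target_of_zero_off_compact (hcompact j) (hχc j) (hcont i j j)
      fun z _ h => by rw [image_eq_zero_of_notMem_tsupport h, zero_mul]
  calc ∑ i ∈ s, ∫ z in (c i).target, χ i ((c i).symm z) * wirtingerBar (ζ (c i)) z
      = ∑ i ∈ s, -∫ z in (c i).target, dbarWedge (χ i) ζ (c i) z :=
        Finset.sum_congr rfl fun i _ =>
          setIntegral_mul_wirtingerBar_eq_neg hζ (hχ i) (hcompact i) (hc i) (hχc i)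
    _ = ∑ i ∈ s, -∑ j ∈ s, ∫ z in (c i).target,
          χ j ((c i).symm z) * dbarWedge (χ i) ζ (c i) z := by
        refine Finset.sum_congr rfl fun i _ => ?_
        rw [← integral_finsetSum s fun j _ => hintFst i j]
        simp only [← Finset.sum_mul, hsum, one_mul]
    _ = ∑ i ∈ s, -∑ j ∈ s, ∫ z in (c j).target,
          χ j ((c j).symm z) * dbarWedge (χ i) ζ (c j) z :=
        Finset.sum_congr rfl fun i _ => congrArg _ (Finset.sum_congr rfl fun j _ =>
          setIntegral_mul_dbarWedge_eq hζ (hχ i) (hc i) (hc j) (hχc i) (hχc j))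
    _ = -∑ j ∈ s, ∫ z in (c j).target,
          χ j ((c j).symm z) * ∑ i ∈ s, dbarWedge (χ i) ζ (c j) z := by
        rw [Finset.sum_neg_distrib, Finset.sum_comm]
        simp only [Finset.mul_sum, integral_finsetSum s fun i _ => hintSnd i _]
    _ = 0 := by
        refine neg_eq_zero.2 (Finset.sum_eq_zero fun j _ =>
          setIntegral_eq_zero_of_forall_eq_zero fun z hz => ?_)
        rw [sum_dbarWedge_eq_zero hχ hsum (hc j) hz, mul_zero]

end Family

end Stokes

/-! ### Integrals over a closed Riemann surface -/

section SurfaceIntegral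

variable {M : Type*} [TopologicalSpace M] [T2Space M] [CompactSpace M] [ChartedSpace ℂ M]
  [IsManifold 𝓘(ℂ) ω M] {E G : Type*} [NormedAddCommGroup E] [NormedSpace ℝ E]
  [NormedAddCommGroup G] [NormedSpace ℝ G] {h h' : OpenPartialHomeomorph M ℂ → ℂ → E}

lemma exists_finset_chartPartition (M : Type*) [TopologicalSpace M] [T2Space M] [CompactSpace M]
    [ChartedSpace ℂ M] [IsManifold 𝓘(ℂ) ω M] : ∃ s : Finset M,
    (∀ p ∉ s, ∀ x, chartPartition M p x = 0) ∧ ∀ x, ∑ p ∈ s, chartPartition M p x = 1 := by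
  have hfin := (chartPartition M).locallyFinite.finite_nonempty_of_compact
  have hzero : ∀ p ∉ hfin.toFinset, ∀ x, chartPartition M p x = 0 := fun p hp x => by
    by_contra hx
    exact hp (hfin.mem_toFinset.2 ⟨x, hx⟩)
  refine ⟨hfin.toFinset, hzero, fun x => ?_⟩
  rw [← (chartPartition M).sum_eq_one (Set.mem_univ x)]
  refine (finsum_eq_sum_of_support_subset _ fun p hp => ?_).symm
  by_contra hps
  exact hp (hzero p hps x)

lemma surfaceIntegral_eq_sum {s : Finset M} (hs : ∀ p ∉ s, ∀ x, chartPartition M p x = 0)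
    (h : OpenPartialHomeomorph M ℂ → ℂ → E) :
    surfaceIntegral h = ∑ p ∈ s, ∫ z in (chartAt ℂ p).target,
      chartPartition M p ((chartAt ℂ p).symm z) • h (chartAt ℂ p) z := by
  refine finsum_eq_sum_of_support_subset _ fun p hp => ?_
  by_contra hps
  exact hp (by simp [hs p hps])

lemma surfaceIntegral_congr (hh : ∀ e ∈ atlas ℂ M, Set.EqOn (h e) (h' e) e.target) :
    surfaceIntegral h = surfaceIntegral h' :=
  finsum_congr fun p => setIntegral_congr_fun (chartAt ℂ p).open_target.measurableSet
    fun z hz => by simp only [hh _ (chart_mem_atlas ℂ p) hz]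

lemma integrableOn_chartPartition_smul {k : ℂ → E} (p : M)
    (hk : ContinuousOn k (chartAt ℂ p).target) :
    IntegrableOn (fun z => chartPartition M p ((chartAt ℂ p).symm z) • k z)
      (chartAt ℂ p).target :=
  integrableOn_target_of_zero_off_compact (isClosed_tsupport (chartPartition M p)).isCompact
    (chartPartition_isSubordinate M p)
    ((contDiffOn_comp_chart_symm (chartPartition M p).contMDiff
      (chart_mem_atlas ℂ p)).continuousOn.smul hk)
    fun z _ hz => by rw [image_eq_zero_of_notMem_tsupport hz, zero_smul]

lemma surfaceIntegral_add (hh : ∀ e ∈ atlas ℂ M, ContinuousOn (h e) e.target)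
    (hh' : ∀ e ∈ atlas ℂ M, ContinuousOn (h' e) e.target) :
    surfaceIntegral (fun e z => h e z + h' e z) = surfaceIntegral h + surfaceIntegral h' := by
  obtain ⟨s, hs, -⟩ := exists_finset_chartPartition M
  simp only [surfaceIntegral_eq_sum hs, smul_add, ← Finset.sum_add_distrib]
  exact Finset.sum_congr rfl fun p _ => integral_add
    (integrableOn_chartPartition_smul p (hh _ (chart_mem_atlas ℂ p)))
    (integrableOn_chartPartition_smul p (hh' _ (chart_mem_atlas ℂ p)))

lemma surfaceIntegral_clm_apply [CompleteSpace E] [CompleteSpace G] (L : E →L[ℝ] G)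
    (hh : ∀ e ∈ atlas ℂ M, ContinuousOn (h e) e.target) :
    surfaceIntegral (fun e z => L (h e z)) = L (surfaceIntegral h) := by
  obtain ⟨s, hs, -⟩ := exists_finset_chartPartition M
  simp only [surfaceIntegral_eq_sum hs, map_sum, ← map_smul]
  exact Finset.sum_congr rfl fun p _ => L.integral_comp_comm
    (integrableOn_chartPartition_smul p (hh _ (chart_mem_atlas ℂ p)))

theorem surfaceIntegral_wirtingerBar_eq_zero {ζ : OpenPartialHomeomorph M ℂ → ℂ → ℂ}
    (hζ : IsOneZeroForm ζ) : surfaceIntegral (fun e z => wirtingerBar (ζ e) z) = 0 := by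
  obtain ⟨s, hs, hsum⟩ := exists_finset_chartPartition M
  have hsupp : ∀ p : M, tsupport (fun x => (chartPartition M p x : ℂ)) ⊆ (chartAt ℂ p).source :=
    fun p => (tsupport_comp_subset Complex.ofReal_zero _).trans (chartPartition_isSubordinate M p)
  simp only [surfaceIntegral_eq_sum hs, Complex.real_smul]
  exact sum_setIntegral_mul_wirtingerBar_eq_zero hζ (fun p => chart_mem_atlas ℂ p)
    (χ := fun p x => (chartPartition M p x : ℂ))
    (fun p => Complex.ofRealCLM.contMDiff.comp (chartPartition M p).contMDiff)
    (fun p => HasCompactSupport.of_compactSpace _) hsupp fun x => mod_cast hsum x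

end SurfaceIntegral

/-! ### Closed surfaces in `SL̃₂` -/

section Immersion

variable {M : Type*} [TopologicalSpace M] [ChartedSpace ℂ M] [IsManifold 𝓘(ℂ) ω M]
  {f : M → SLTilde}

lemma IsConformalImmersion.contDiffOn_coords_comp_symm (hf : IsConformalImmersion f)
    {e : OpenPartialHomeomorph M ℂ} (he : e ∈ atlas ℂ M) :
    ContDiffOn ℝ ∞ (fun z => coords (f (e.symm z))) e.target :=
  contDiffOn_comp_chart_symm (g := fun p => coords (f p)) hf.smooth he

lemma IsConformalImmersion.fderiv_coords_comp_symm_ne_zero (hf : IsConformalImmersion f)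
    {e : OpenPartialHomeomorph M ℂ} (he : e ∈ atlas ℂ M) {z : ℂ} (hz : z ∈ e.target) {u : ℂ}
    (hu : u ≠ 0) : fderiv ℝ (fun w => coords (f (e.symm w))) z u ≠ 0 := by
  have := isManifold_real_of_complex M
  have : IsManifold 𝓘(ℝ, ℂ) 1 M := IsManifold.of_le (n := ∞) (by simp)
  have hchart := mdifferentiable_of_mem_atlas (I := 𝓘(ℝ, ℂ)) he
  have hcomp : mfderiv 𝓘(ℝ, ℂ) 𝓘(ℝ, ℝ × ℂ) (f ∘ e.symm) z = _ :=
    mfderiv_comp z (hf.smooth.mdifferentiableAt (by simp)) (hchart.mdifferentiableAt_symm hz)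
  have hinj : Function.Injective (mfderiv 𝓘(ℝ, ℂ) 𝓘(ℝ, ℝ × ℂ) (f ∘ e.symm) z) := by
    rw [hcomp]
    exact (hf.immersion (e.symm z)).comp (hchart.symm.mfderiv_injective hz)
  have hfderiv : mfderiv 𝓘(ℝ, ℂ) 𝓘(ℝ, ℝ × ℂ) (f ∘ e.symm) z =
      fderiv ℝ (fun w => coords (f (e.symm w))) z := mfderiv_eq_fderiv
  rw [hfderiv] at hinj
  exact fun h0 => hu (hinj (h0.trans (map_zero _).symm))

theorem IsConformalImmersion.isConformalOn (hf : IsConformalImmersion f)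
    {e : OpenPartialHomeomorph M ℂ} (he : e ∈ atlas ℂ M) :
    IsConformalOn (f ∘ e.symm) e.target := by
  have hcoords : ∀ z ∈ e.target, ContDiffAt ℝ ∞ (fun w => coords ((f ∘ e.symm) w)) z :=
    fun z hz => (hf.contDiffOn_coords_comp_symm he).contDiffAt (e.open_target.mem_nhds hz)
  exact {
    isOpen := e.open_target
    smoothAt := fun z hz => SmoothAt.of_contDiffAt_coords (hcoords z hz)
    sq_eq := fun z hz => (hf.conformal e he z hz).1
    orthogonal := fun z hz => (hf.conformal e he z hz).2
    velocity_ne_zero := fun z hz h0 => hf.fderiv_coords_comp_symm_ne_zero he hz one_ne_zero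
      (fderiv_coords_eq_zero (hcoords z hz) h0) }

theorem IsConformalImmersion.isOneZeroForm_zCoeff (hf : IsConformalImmersion f) (k : Fin 3) :
    IsOneZeroForm fun (e : OpenPartialHomeomorph M ℂ) z => zCoeff (f ∘ e.symm) z k where
  contDiffOn e he z hz :=
    ((((hf.isConformalOn he).smoothAt z hz).contDiffAt_zCoeff k).of_le
      (by simp)).contDiffWithinAt
  eq_deriv_mul e he e' he' z hz := by
    have hnear : f ∘ e.symm =ᶠ[nhds z] (f ∘ e'.symm) ∘ e.symm.trans e' :=
      (eventually_symm_transition_eq hz).mono fun w hw => congrArg f hw.symm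
    exact (zCoeff_congr hnear k).trans
      (((hf.isConformalOn he').smoothAt _ (transition_mem_target hz)).zCoeff_comp
        (hasDerivAt_transition he he' hz) k)

lemma IsConformalImmersion.isDiracPotential_diracPotentials (hf : IsConformalImmersion f)
    {e : OpenPartialHomeomorph M ℂ} (he : e ∈ atlas ℂ M) :
    IsDiracPotential (f ∘ e.symm) e.target (diracPotentials f e).1 (diracPotentials f e).2 :=
  Classical.epsilon_spec (p := fun P : (ℂ → ℂ) × (ℂ → ℂ) =>
    IsDiracPotential (f ∘ e.symm) e.target P.1 P.2) ⟨(_, _), (hf.isConformalOn he).isDiracPotential⟩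

lemma IsConformalImmersion.diracPotentials_mul_eq (hf : IsConformalImmersion f)
    {e : OpenPartialHomeomorph M ℂ} (he : e ∈ atlas ℂ M) {z : ℂ} (hz : z ∈ e.target) :
    (diracPotentials f e).1 z * (diracPotentials f e).2 z =
      energyDensity (f ∘ e.symm) z -
        5 / 4 * Complex.I * (wirtingerBar (fun w => zCoeff (f ∘ e.symm) w 2) z).re := by
  have hconf := hf.isConformalOn he
  obtain ⟨hU, hV⟩ := hconf.eqOn_of_isDiracPotential (hf.isDiracPotential_diracPotentials he)
    hconf.isDiracPotential
  rw [hU hz, hV hz, hconf.potentialFst_mul_potentialSnd hz]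

theorem IsConformalImmersion.energy_eq [T2Space M] [CompactSpace M]
    (hf : IsConformalImmersion f) : energy f =
      ((surfaceIntegral fun (e : OpenPartialHomeomorph M ℂ) z =>
        energyDensity (f ∘ e.symm) z : ℝ) : ℂ) := by
  let L : ℂ →L[ℝ] ℂ := (-(5 / 4 * Complex.I)) • Complex.ofRealCLM.comp Complex.reCLM
  have hform := hf.isOneZeroForm_zCoeff 2
  have hdensity : ∀ e ∈ atlas ℂ M, ContinuousOn (energyDensity (f ∘ e.symm)) e.target :=
    fun e he => (hf.isConformalOn he).continuousOn_energyDensity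
  have hbar : ∀ e ∈ atlas ℂ M,
      ContinuousOn (wirtingerBar fun w => zCoeff (f ∘ e.symm) w 2) e.target := fun e he =>
    continuousOn_wirtingerBar e.open_target (hform.contDiffOn e he)
  calc energy f = surfaceIntegral fun (e : OpenPartialHomeomorph M ℂ) z =>
        Complex.ofRealCLM (energyDensity (f ∘ e.symm) z) +
          L (wirtingerBar (fun w => zCoeff (f ∘ e.symm) w 2) z) :=
        surfaceIntegral_congr fun e he z hz => by
          simp only [hf.diracPotentials_mul_eq he hz]
          simp [L, sub_eq_add_neg]
    _ = Complex.ofRealCLM (surfaceIntegral fun (e : OpenPartialHomeomorph M ℂ) z =>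
          energyDensity (f ∘ e.symm) z) +
        L (surfaceIntegral fun (e : OpenPartialHomeomorph M ℂ) z =>
          wirtingerBar (fun w => zCoeff (f ∘ e.symm) w 2) z) := (surfaceIntegral_add
          (fun e he => Complex.ofRealCLM.continuous.comp_continuousOn (hdensity e he))
          fun e he => L.continuous.comp_continuousOn (hbar e he)).trans
        (congrArg₂ (· + ·) (surfaceIntegral_clm_apply Complex.ofRealCLM hdensity)
          (surfaceIntegral_clm_apply L hbar))
    _ = _ := by
        rw [surfaceIntegral_wirtingerBar_eq_zero hform, map_zero, add_zero,
          Complex.ofRealCLM_apply]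

end Immersion

theorem mainTheorem8 {M : Type*} [TopologicalSpace M] [T2Space M] [CompactSpace M]
    [ChartedSpace ℂ M] [IsManifold 𝓘(ℂ) ω M] (f : M → SLTilde) (hf : IsConformalImmersion f) :
    (∀ e ∈ atlas ℂ M, ∃ U V : ℂ → ℂ,
      SLTilde.IsDiracPotential (f ∘ e.symm) e.target U V ∧
      ∀ U' V' : ℂ → ℂ, SLTilde.IsDiracPotential (f ∘ e.symm) e.target U' V' →
        Set.EqOn U' U e.target ∧ Set.EqOn V' V e.target) ∧
    (energy f).im = 0 ∧
    energy f = ((surfaceIntegral fun (e : OpenPartialHomeomorph M ℂ) (z : ℂ) =>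
      SLTilde.meanCurvature (f ∘ e.symm) z ^ 2 / 4 *
          (‖(SLTilde.spinor (f ∘ e.symm) z).1‖ ^ 2 + ‖(SLTilde.spinor (f ∘ e.symm) z).2‖ ^ 2) ^ 2 -
        (1 / 2 * ‖(SLTilde.spinor (f ∘ e.symm) z).1‖ ^ 2 -
            3 / 4 * ‖(SLTilde.spinor (f ∘ e.symm) z).2‖ ^ 2) *
          (3 / 4 * ‖(SLTilde.spinor (f ∘ e.symm) z).1‖ ^ 2 -
            1 / 2 * ‖(SLTilde.spinor (f ∘ e.symm) z).2‖ ^ 2) : ℝ) : ℂ) := by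
  have hconf := fun e (he : e ∈ atlas ℂ M) => hf.isConformalOn he
  refine ⟨fun e he => ⟨_, _, (hconf e he).isDiracPotential, fun U' V' h' =>
    (hconf e he).eqOn_of_isDiracPotential h' (hconf e he).isDiracPotential⟩, ?_, ?_⟩
  · rw [hf.energy_eq, Complex.ofReal_im]
  · rw [hf.energy_eq]
    exact congrArg _ (surfaceIntegral_congr fun e he z hz => (hconf e he).energyDensity_eq hz)
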